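/- Let $r\ge 2$ be an integer, let $c,\varepsilon$ be real numbers and $n$ a positive integer such that $$0<c<r^{-8(r+21)(r+1)},\qquad 0<\varepsilon<2^{-36}r^{-24},\qquad n>\exp(1/c),$$ and let $G$ be a (finite simple) graph of order $n$. Let $\mu(G)$ denote the spectral radius of $G$, i.e. the largest eigenvalue of its adjacency matrix. If $$\mu(G)>\left(1-\frac1r-\varepsilon\right)n,$$ then at least one of the following statements holds: (a) $G$ contains, as a (not necessarily induced) subgraph, a $K_{r+1}\left(\lfloor c\log n\rfloor;\lceil n^{1-\sqrt c}\,\rceil\right)$, where $\log$ is the natural logarithm and $K_{r+1}(s;t)$ is the complete $(r+1)$-partite graph with $r$ classes of size $s$ and one class of size $t$; (b) $G$ differs from $T_r(n)$ in fewer than $\left(\varepsilon^{1/4}+c^{1/(8r+8)}\right)n^2$ edges, where $T_r(n)$ is the Turán graph, the complete $r$-partite graph of order $n$ whose class sizes differ by at most one; that is, there is a graph $T$ isomorphic to $T_r(n)$ on the vertex set of $G$ such that the symmetric difference $E(G)\,\triangle\,E(T)$ has fewer than that many elements. -/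

import Mathlib

open scoped SimpleGraph

/-- `μ(G)`: the largest eigenvalue of the adjacency matrix of the finite graph `G`
(over a field, the spectrum of a matrix is its set of eigenvalues). -/
noncomputable def graphSpectralRadius {V : Type*} [Fintype V] (G : SimpleGraph V) : ℝ :=
  open Classical in sSup (spectrum ℝ (G.adjMatrix ℝ))

/-- Two sanity properties of `graphSpectralRadius`: on a nonempty vertex set it is an eigenvalue
of the adjacency matrix and no eigenvalue exceeds it. -/
theorem isGreatest_graphSpectralRadius {V : Type*} [Fintype V] [DecidableEq V] [Nonempty V]
    (G : SimpleGraph V) [DecidableRel G.Adj] :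
    IsGreatest (spectrum ℝ (G.adjMatrix ℝ)) (graphSpectralRadius G) := by
  have hA : (G.adjMatrix ℝ).IsHermitian := by
    rw [Matrix.IsHermitian, Matrix.conjTranspose_eq_transpose_of_trivial]
    exact G.isSymm_adjMatrix
  have h : IsGreatest (spectrum ℝ (G.adjMatrix ℝ)) (sSup (spectrum ℝ (G.adjMatrix ℝ))) := by
    rw [hA.spectrum_real_eq_range_eigenvalues]
    exact ⟨(Set.range_nonempty _).csSup_mem (Set.finite_range _),
      fun x hx => le_csSup (Set.finite_range _).bddAbove hx⟩
  convert h using 1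
  unfold graphSpectralRadius
  congr!

/-- `K_k(s; t)`: the complete `k`-partite graph whose first `k - 1` classes have `s` vertices
and whose last class has `t` vertices. -/
abbrev completePartiteOneLarge (k s t : ℕ) :
    SimpleGraph (Σ i : Fin k, Fin (if (i : ℕ) + 1 = k then t else s)) :=
  SimpleGraph.completeMultipartiteGraph fun i : Fin k => Fin (if (i : ℕ) + 1 = k then t else s)

/-- `G` differs from the graph `H` in fewer than `x` edges: some copy `T` of `H` on the vertex
set of `G` satisfies `|E(G) ∆ E(T)| < x`. -/
def DiffersInFewerThan {V W : Type*} (G : SimpleGraph V) (H : SimpleGraph W) (x : ℝ) : Prop :=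
  ∃ T : SimpleGraph V, Nonempty (T ≃g H) ∧ ((symmDiff G.edgeSet T.edgeSet).ncard : ℝ) < x

/-! ### Weighted clique counts and the Moon–Moser inequality -/

section CliqueWeights

open Classical Finset

variable {V : Type*}

/-! Write `η = c ^ (1 / (8r + 8))`, `e = ε ^ (1/4)`, `d = η ^ 8`, so that `d ^ (r + 1) = c`. The
proof is a dichotomy on whether `G` has at least `(r + 1) d n ^ (r + 1)` ordered `(r + 1)`-cliques.

Many cliques: an iterated Kővári–Sós–Turán argument (`exists_common_subset`, `exists_blowup_extend`,
`exists_blowup`) builds the classes one at a time. The last class may take all remaining common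
vertices, which gives its size `n ^ (1 - √c)`.

Few cliques: let `q_k` be the total weight of the ordered `k`-cliques for vertex weights of sum 1.
The Moon–Moser inequality bounds the ratios `q_(k+1) / q_k` below in terms of `q_2`
(`cliqueWeight_succ_ge`). It is used twice. With the squared entries of an eigenvector as weights,
it gives an approximate Motzkin–Straus bound (`cliqueWeight_two_le`). Since `μ² ≤ 2 e(G) q_2`, the
graph has at least about `(1 - 1/r) n² / 2` edges (`card_adjPairs_ge_of_spectralRadius`). With
uniform weights, averaging over `r`-cliques produces a clique `x` for which few vertices lie outside
the sets "adjacent to all of `x` but `x i`" and few edges lie inside them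
(`exists_clique_outside_inside_le`). Edge counting then forces these `r` disjoint sets to be nearly
equal in size and nearly completely joined, hence `G` is close to `T_r(n)`
(`differsInFewerThan_turanGraph`). -/

/-- An ordered clique: a tuple of pairwise adjacent vertices. -/
def IsCliqueTuple (G : SimpleGraph V) {k : ℕ} (x : Fin k → V) : Prop :=
  Pairwise fun i j => G.Adj (x i) (x j)

/-- The product of the vertex weights of an ordered clique, and `0` for other tuples. -/
noncomputable def tupleWeight (G : SimpleGraph V) (y : V → ℝ) {k : ℕ} (x : Fin k → V) : ℝ :=
  if IsCliqueTuple G x then ∏ i, y (x i) else 0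

/-- The total weight of the ordered `k`-cliques. -/
noncomputable def cliqueWeight [Fintype V] (G : SimpleGraph V) (y : V → ℝ) (k : ℕ) : ℝ :=
  ∑ x : Fin k → V, tupleWeight G y x

/-- The weight of `u` if `u` is adjacent to the whole tuple, and `0` otherwise. -/
noncomputable def joinWeight (G : SimpleGraph V) (y : V → ℝ) {k : ℕ} (x : Fin k → V) (u : V) : ℝ :=
  if ∀ j, G.Adj u (x j) then y u else 0

/-- The vertices adjacent to all entries of `x` except the `i`-th one. -/
noncomputable def cliquePart [Fintype V] (G : SimpleGraph V) {k : ℕ} (x : Fin k → V) (i : Fin k) : Finset V :=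
  {u | ¬ G.Adj u (x i) ∧ ∀ j, j ≠ i → G.Adj u (x j)}

/-- The vertices in none of the parts defined by `x`. -/
noncomputable def cliqueOutside [Fintype V] (G : SimpleGraph V) {k : ℕ} (x : Fin k → V) : Finset V :=
  {u | ∀ i, u ∉ cliquePart G x i}

variable (G : SimpleGraph V) {y : V → ℝ}

theorem tupleWeight_nonneg (hy : ∀ v, 0 ≤ y v) {k : ℕ} (x : Fin k → V) :
    0 ≤ tupleWeight G y x := by
  unfold tupleWeight
  split_ifs
  · exact prod_nonneg fun i _ => hy _
  · exact le_rfl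

theorem joinWeight_nonneg (hy : ∀ v, 0 ≤ y v) {k : ℕ} (x : Fin k → V) (u : V) :
    0 ≤ joinWeight G y x u := by
  unfold joinWeight
  split_ifs
  · exact hy u
  · exact le_rfl

theorem isCliqueTuple_insertNth {k : ℕ} (i : Fin (k + 1)) (u : V) (x : Fin k → V) :
    IsCliqueTuple G (i.insertNth (α := fun _ => V) u x) ↔
      (∀ j, G.Adj u (x j)) ∧ IsCliqueTuple G x := by
  constructor
  · intro h
    refine ⟨fun j => ?_, fun j l hjl => ?_⟩
    · simpa using h (Fin.succAbove_ne i j).symm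
    · simpa using h (fun e => hjl (Fin.succAbove_right_injective e) :
        i.succAbove j ≠ i.succAbove l)
  · rintro ⟨h₁, h₂⟩ a b hab
    rcases Fin.eq_self_or_eq_succAbove i a with rfl | ⟨j, rfl⟩
    · rcases Fin.eq_self_or_eq_succAbove a b with rfl | ⟨l, rfl⟩
      · exact absurd rfl hab
      · simpa using h₁ l
    · rcases Fin.eq_self_or_eq_succAbove i b with rfl | ⟨l, rfl⟩
      · simpa using (h₁ j).symm
      · simpa using h₂ (fun e => hab (by rw [e]) : j ≠ l)

theorem tupleWeight_insertNth {k : ℕ} (i : Fin (k + 1)) (u : V) (x : Fin k → V) :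
    tupleWeight G y (i.insertNth (α := fun _ => V) u x) =
      joinWeight G y x u * tupleWeight G y x := by
  unfold tupleWeight joinWeight
  rw [isCliqueTuple_insertNth, Fin.prod_univ_succAbove _ i]
  by_cases h₁ : ∀ j, G.Adj u (x j) <;> by_cases h₂ : IsCliqueTuple G x <;> simp [h₁, h₂]

theorem tupleWeight_fin_zero (x : Fin 0 → V) : tupleWeight G y x = 1 := by
  have h : IsCliqueTuple G x := fun i => i.elim0
  simp [tupleWeight, h]

variable [Fintype V]

theorem cliqueWeight_nonneg (hy : ∀ v, 0 ≤ y v) (k : ℕ) : 0 ≤ cliqueWeight G y k :=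
  sum_nonneg fun x _ => tupleWeight_nonneg G hy x

theorem sum_insertNth {k : ℕ} (i : Fin (k + 1)) (f : (Fin (k + 1) → V) → ℝ) :
    ∑ x, f x = ∑ x : Fin k → V, ∑ u, f (i.insertNth (α := fun _ => V) u x) := by
  rw [← (Fin.insertNthEquiv (fun _ => V) i).sum_comp, Fintype.sum_prod_type, sum_comm]
  rfl

theorem cliqueWeight_succ (k : ℕ) :
    cliqueWeight G y (k + 1) =
      ∑ x : Fin k → V, tupleWeight G y x * ∑ u, joinWeight G y x u := by
  unfold cliqueWeight
  rw [sum_insertNth 0]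
  refine sum_congr rfl fun x _ => ?_
  rw [mul_sum]
  exact sum_congr rfl fun u _ => by rw [tupleWeight_insertNth, mul_comm]

theorem cliqueWeight_one (h : ∑ v, y v = 1) : cliqueWeight G y 1 = 1 := by
  rw [cliqueWeight_succ, Fintype.sum_unique, tupleWeight_fin_zero, one_mul, ← h]
  exact sum_congr rfl fun u _ => if_pos fun j => j.elim0

theorem cliqueWeight_two :
    cliqueWeight G y 2 = ∑ u, ∑ v, if G.Adj u v then y u * y v else 0 := by
  unfold cliqueWeight
  rw [sum_insertNth 0, ← (Equiv.funUnique (Fin 1) V).symm.sum_comp, sum_comm]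
  refine sum_congr rfl fun u _ => sum_congr rfl fun v _ => ?_
  rw [tupleWeight_insertNth]
  have h₁ : IsCliqueTuple G ((Equiv.funUnique (Fin 1) V).symm v) :=
    fun i j hij => absurd (Subsingleton.elim i j) hij
  rw [tupleWeight, if_pos h₁]
  simp [joinWeight]

/-- Split by the number of entries of `x` not adjacent to `u`. With none, `u` counts for every `i`
and is also outside, because a part demands a non-neighbour. With one, only that index counts; with
two or more, only the outside term survives. -/
theorem sum_ite_forall_ne_add_le {k : ℕ} (x : Fin (k + 1) → V) (u : V) :
    (∑ i, if ∀ j, j ≠ i → G.Adj u (x j) then (1 : ℝ) else 0) +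
        (if u ∈ cliqueOutside G x then 1 else 0) ≤
      1 + ((k : ℝ) + 1) * if ∀ j, G.Adj u (x j) then 1 else 0 := by
  by_cases hf : ∀ j, G.Adj u (x j)
  · have : (∑ i : Fin (k + 1), if ∀ j, j ≠ i → G.Adj u (x j) then (1 : ℝ) else 0) = k + 1 := by
      rw [sum_congr rfl fun i _ => if_pos fun j _ => hf j]
      simp
    rw [this, if_pos hf]
    split_ifs <;> linarith
  · rw [if_neg hf, mul_zero, add_zero]
    by_cases ho : u ∈ cliqueOutside G x
    · rw [if_pos ho, sum_eq_zero]
      · simp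
      intro i _
      rw [if_neg]
      intro hi
      simp only [cliqueOutside, cliquePart, mem_filter, mem_univ, true_and] at ho
      refine hf fun j => ?_
      by_contra hj
      by_cases hji : j = i
      · exact ho i ⟨hji ▸ hj, hi⟩
      · exact hj (hi j hji)
    · rw [if_neg ho, add_zero]
      push Not at hf
      obtain ⟨l, hl⟩ := hf
      calc _ ≤ ∑ i : Fin (k + 1), if i = l then (1 : ℝ) else 0 := by
            refine sum_le_sum fun i _ => ?_
            by_cases hil : i = l
            · rw [if_pos hil]; split_ifs <;> norm_num
            · rw [if_neg hil, if_neg]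
              exact fun h => hl (h l (Ne.symm hil))
        _ = 1 := by simp

/-- Double counting: once the `i`-th entry is removed, that entry and `u` are two independent
extensions of the same `k`-clique, whence the square. Each of the `k + 1` indices gives the same
sum. -/
theorem sum_tupleWeight_mul_sum_ite_forall_ne (k : ℕ) :
    ∑ x : Fin (k + 1) → V, tupleWeight G y x * ∑ u, y u *
        ∑ i, (if ∀ j, j ≠ i → G.Adj u (x j) then (1 : ℝ) else 0) =
      ((k : ℝ) + 1) * ∑ x : Fin k → V, tupleWeight G y x * (∑ u, joinWeight G y x u) ^ 2 := by
  have h₁ : ∀ x : Fin (k + 1) → V, tupleWeight G y x * ∑ u, y u *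
        ∑ i, (if ∀ j, j ≠ i → G.Adj u (x j) then (1 : ℝ) else 0) =
      ∑ i, tupleWeight G y x * ∑ u, if ∀ j, j ≠ i → G.Adj u (x j) then y u else 0 := by
    intro x
    rw [← mul_sum, sum_comm]
    simp_rw [mul_sum, mul_ite, mul_one, mul_zero]
  simp_rw [h₁]
  rw [sum_comm]
  have h₂ : ∀ i : Fin (k + 1), ∑ x : Fin (k + 1) → V, tupleWeight G y x *
        ∑ u, (if ∀ j, j ≠ i → G.Adj u (x j) then y u else 0) =
      ∑ x : Fin k → V, tupleWeight G y x * (∑ u, joinWeight G y x u) ^ 2 := by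
    intro i
    rw [sum_insertNth i]
    refine sum_congr rfl fun x _ => ?_
    have h₃ : ∀ v u, (if ∀ j, j ≠ i → G.Adj u (i.insertNth (α := fun _ => V) v x j)
        then y u else 0) = joinWeight G y x u := by
      intro v u
      unfold joinWeight
      refine if_congr ⟨fun h j => ?_, fun h j hj => ?_⟩ rfl rfl
      · simpa using h _ (Fin.succAbove_ne i j)
      · obtain ⟨l, rfl⟩ := Fin.exists_succAbove_eq hj
        simpa using h l
    simp_rw [h₃, tupleWeight_insertNth]
    rw [← sum_mul, ← sum_mul]
    ring
  simp_rw [h₂]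
  simp

/-- A common neighbour of all entries of `x` belongs to no part, so it is counted outside. -/
theorem sum_tupleWeight_mul_outside_ge (hy : ∀ v, 0 ≤ y v) (k : ℕ) :
    cliqueWeight G y (k + 1) ≤
      ∑ x : Fin k → V, tupleWeight G y x * ∑ u ∈ cliqueOutside G x, y u := by
  rw [cliqueWeight_succ]
  refine sum_le_sum fun x _ => mul_le_mul_of_nonneg_left ?_ (tupleWeight_nonneg G hy x)
  unfold joinWeight
  rw [← sum_filter]
  refine sum_le_sum_of_subset_of_nonneg (fun u hu => ?_) fun u _ _ => hy u
  simp only [cliqueOutside, cliquePart, mem_filter, mem_univ, true_and] at hu ⊢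
  exact fun i h => h.1 (hu i)

/-- A weighted Moon–Moser inequality, keeping track of the weight outside the parts. -/
theorem moonMoser_outside (hy : ∀ v, 0 ≤ y v) (h1 : ∑ v, y v = 1) (k : ℕ) :
    ((k : ℝ) + 1) * cliqueWeight G y (k + 1) ^ 2 + cliqueWeight G y k *
        (∑ x : Fin (k + 1) → V, tupleWeight G y x * ∑ u ∈ cliqueOutside G x, y u) ≤
      cliqueWeight G y k *
        (cliqueWeight G y (k + 1) + ((k : ℝ) + 1) * cliqueWeight G y (k + 2)) := by
  -- Cauchy–Schwarz over `k`-cliques: first moment squared against second moment of the extension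
  -- weight. `hsum` then bounds the second moment pointwise in `u`.
  have hCS : cliqueWeight G y (k + 1) ^ 2 ≤ cliqueWeight G y k *
      ∑ x : Fin k → V, tupleWeight G y x * (∑ u, joinWeight G y x u) ^ 2 := by
    rw [cliqueWeight_succ]
    refine sum_sq_le_sum_mul_sum_of_sq_le_mul _ (fun x _ => tupleWeight_nonneg G hy x)
      (fun x _ => mul_nonneg (tupleWeight_nonneg G hy x) (sq_nonneg _)) fun x _ => le_of_eq ?_
    ring
  have hsum : ((k : ℝ) + 1) * (∑ x : Fin k → V, tupleWeight G y x *
        (∑ u, joinWeight G y x u) ^ 2) +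
      (∑ x : Fin (k + 1) → V, tupleWeight G y x * ∑ u ∈ cliqueOutside G x, y u) ≤
      cliqueWeight G y (k + 1) + ((k : ℝ) + 1) * cliqueWeight G y (k + 2) := by
    rw [← sum_tupleWeight_mul_sum_ite_forall_ne, cliqueWeight_succ G (k + 1), mul_sum,
      ← sum_add_distrib]
    unfold cliqueWeight
    rw [← sum_add_distrib]
    refine sum_le_sum fun x _ => ?_
    calc _ = tupleWeight G y x * ∑ u, y u *
          ((∑ i, if ∀ j, j ≠ i → G.Adj u (x j) then (1 : ℝ) else 0) +
            (if u ∈ cliqueOutside G x then 1 else 0)) := by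
          rw [← mul_add]
          simp only [mul_add, sum_add_distrib, mul_ite, mul_one, mul_zero, sum_ite_mem, univ_inter]
      _ ≤ tupleWeight G y x * ∑ u, y u *
          (1 + ((k : ℝ) + 1) * if ∀ j, G.Adj u (x j) then 1 else 0) :=
          mul_le_mul_of_nonneg_left (sum_le_sum fun u _ =>
            mul_le_mul_of_nonneg_left (sum_ite_forall_ne_add_le G x u) (hy u))
            (tupleWeight_nonneg G hy x)
      _ = _ := by
          have : ∀ u, y u * (1 + ((k : ℝ) + 1) * if ∀ j, G.Adj u (x j) then 1 else 0) =
              y u + (k + 1) * joinWeight G y x u := by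
            intro u
            unfold joinWeight
            split_ifs <;> ring
          simp_rw [this]
          rw [sum_add_distrib, h1, ← mul_sum]
          ring
  have hk := cliqueWeight_nonneg G hy k
  have hk1 : (0 : ℝ) ≤ k + 1 := by positivity
  nlinarith [mul_le_mul_of_nonneg_left hsum hk, mul_le_mul_of_nonneg_left hCS hk1]

/-- The outside term is at least `cliqueWeight G y (k + 2)`, which cancels one of the `k + 1` copies
on the right. -/
theorem moonMoser (hy : ∀ v, 0 ≤ y v) (h1 : ∑ v, y v = 1) (k : ℕ) :
    ((k : ℝ) + 1) * cliqueWeight G y (k + 1) ^ 2 ≤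
      cliqueWeight G y k * (cliqueWeight G y (k + 1) + (k : ℝ) * cliqueWeight G y (k + 2)) := by
  have h := moonMoser_outside G hy h1 k
  have h' := mul_le_mul_of_nonneg_left (sum_tupleWeight_mul_outside_ge G hy (k + 1))
    (cliqueWeight_nonneg G hy k)
  linarith

/-- With `ρ_s = q_(s+2) / q_(s+1)`, Moon–Moser reads `(s + 1)(1 - ρ_(s+1)) ≤ (s + 2)(1 - ρ_s)`: the
quantity `(1 - ρ_s) / (s + 1)` does not increase, and it starts at most at `1/r + a`. The bound on
`a` keeps the ratios used before the last one at least `1 / (2r)`, which gives the first conclusion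
and the positivity needed for division. Negative `a` is allowed. -/
theorem cliqueWeight_succ_ge (hy : ∀ v, 0 ≤ y v) (h1 : ∑ v, y v = 1) {r : ℕ} (hr : 2 ≤ r)
    {a : ℝ} (ha : a ≤ 1 / (2 * (r : ℝ) ^ 2))
    (h2 : 1 - 1 / (r : ℝ) - a ≤ cliqueWeight G y 2) (s : ℕ) (hs : s + 1 ≤ r) :
    (1 / (2 * (r : ℝ))) ^ s ≤ cliqueWeight G y (s + 1) ∧
      (1 - ((s : ℝ) + 1) / r - ((s : ℝ) + 1) * a) * cliqueWeight G y (s + 1) ≤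
        cliqueWeight G y (s + 2) := by
  have hr0 : (0 : ℝ) < r := by positivity
  induction s with
  | zero =>
    have := cliqueWeight_one G h1
    simp only [zero_add, this, pow_zero, CharP.cast_eq_zero, one_mul, mul_one, le_refl, true_and]
    exact h2
  | succ s ih =>
    obtain ⟨hpow, hge⟩ := ih (by omega)
    have hpos : 0 < cliqueWeight G y (s + 1) := lt_of_lt_of_le (by positivity) hpow
    have hsr : (s : ℝ) + 1 + 1 ≤ r := by exact_mod_cast hs
    have hlow : 1 / (2 * (r : ℝ)) ≤ 1 - ((s : ℝ) + 1) / r - ((s : ℝ) + 1) * a := by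
      have e1 : ((s : ℝ) + 1) / r ≤ 1 - 1 / r := by
        rw [div_le_iff₀ hr0, sub_mul, one_div, inv_mul_cancel₀ hr0.ne']
        linarith
      have e2 : ((s : ℝ) + 1) * a ≤ 1 / (2 * r) := by
        calc ((s : ℝ) + 1) * a ≤ ((s : ℝ) + 1) * (1 / (2 * (r : ℝ) ^ 2)) := by gcongr
          _ ≤ r * (1 / (2 * (r : ℝ) ^ 2)) := by gcongr; linarith
          _ = 1 / (2 * r) := by field_simp
      have e3 : 1 / (r : ℝ) = 1 / (2 * r) + 1 / (2 * r) := by field_simp; norm_num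
      linarith
    have hpow' : (1 / (2 * (r : ℝ))) ^ (s + 1) ≤ cliqueWeight G y (s + 2) := by
      calc (1 / (2 * (r : ℝ))) ^ (s + 1) = 1 / (2 * (r : ℝ)) * (1 / (2 * (r : ℝ))) ^ s := by ring
        _ ≤ (1 - ((s : ℝ) + 1) / r - ((s : ℝ) + 1) * a) * cliqueWeight G y (s + 1) := by
          have : (0 : ℝ) ≤ 1 / (2 * r) := by positivity
          gcongr
          exact this.trans hlow
        _ ≤ _ := hge
    refine ⟨hpow', ?_⟩
    have hpos' : 0 < cliqueWeight G y (s + 2) := lt_of_lt_of_le (by positivity) hpow'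
    have hm := moonMoser G hy h1 (s + 1)
    push_cast at hm ⊢
    rw [show s + 1 + 1 = s + 2 from rfl, show s + 1 + 2 = s + 3 from rfl] at *
    set q := cliqueWeight G y (s + 1)
    set q' := cliqueWeight G y (s + 2)
    set q'' := cliqueWeight G y (s + 3)
    have h3 : ((s : ℝ) + 1 + 1) * (1 - ((s : ℝ) + 1) / r - ((s : ℝ) + 1) * a) * q' ≤
        q' + (s + 1) * q'' := by
      have : q * (((s : ℝ) + 1 + 1) * (1 - ((s : ℝ) + 1) / r - ((s : ℝ) + 1) * a) * q') ≤
          q * (q' + (s + 1) * q'') := by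
        refine le_trans ?_ hm
        have := mul_le_mul_of_nonneg_left hge
          (by positivity : (0 : ℝ) ≤ ((s : ℝ) + 1 + 1) * q')
        nlinarith
      exact le_of_mul_le_mul_left this hpos
    have hs1 : (0 : ℝ) < s + 1 := by positivity
    refine le_of_mul_le_mul_left ?_ hs1
    have : ((s : ℝ) + 1) * ((1 - ((s : ℝ) + 1 + 1) / r - ((s : ℝ) + 1 + 1) * a) * q') =
        ((s : ℝ) + 1 + 1) * (1 - ((s : ℝ) + 1) / r - ((s : ℝ) + 1) * a) * q' - q' := by
      field_simp
      ring
    rw [this]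
    linarith

end CliqueWeights

/-! ### From many cliques to a complete multipartite subgraph -/

section Blowup

open Classical Finset

variable {V : Type*} [Fintype V]

/-- Double counting shows that at least `d n / 2` vertices lie in `s` or more of the sets `N j`.
Each selects `s` such indices, and pigeonhole over at most `2 ^ m` index sets finds a popular
choice. -/
theorem exists_common_subset {m s : ℕ} (hs : 0 < s) {d : ℝ} (hd : 2 * (s : ℝ) ≤ m * d)
    (hd1 : d ≤ 1) (N : Fin m → Finset V) (hN : ∀ j, d * Fintype.card V ≤ #(N j)) :
    ∃ (S : Finset (Fin m)) (T : Finset V), #S = s ∧ (∀ v ∈ T, ∀ j ∈ S, v ∈ N j) ∧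
      d / 2 * Fintype.card V ≤ #T * 2 ^ m := by
  set n := Fintype.card V with hn
  have hsR : (0 : ℝ) < s := by exact_mod_cast hs
  have hm : (0 : ℝ) < m := by
    rcases Nat.eq_zero_or_pos m with rfl | h
    · norm_num at hd; linarith
    · exact_mod_cast h
  have hsm : s ≤ m := by
    have : (s : ℝ) ≤ m := by nlinarith
    exact_mod_cast this
  set A : Finset V := {v | s ≤ #{j | v ∈ N j}} with hA
  have hcount : (∑ j, (#(N j) : ℝ)) = ∑ v, (#{j | v ∈ N j} : ℝ) := by
    have h := sum_card_bipartiteAbove_eq_sum_card_bipartiteBelow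
      (s := (univ : Finset (Fin m))) (t := (univ : Finset V)) fun j v => v ∈ N j
    simp only [bipartiteAbove, bipartiteBelow, filter_univ_mem] at h
    exact_mod_cast h
  have hup : ∑ v, (#{j | v ∈ N j} : ℝ) ≤ #A * m + n * s := by
    calc ∑ v, (#{j | v ∈ N j} : ℝ) ≤ ∑ v, ((if v ∈ A then (m : ℝ) else 0) + s) := by
          refine sum_le_sum fun v _ => ?_
          by_cases hv : v ∈ A
          · rw [if_pos hv]
            have : #{j | v ∈ N j} ≤ m := (card_le_univ _).trans (by simp)
            have : (#{j | v ∈ N j} : ℝ) ≤ m := by exact_mod_cast this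
            linarith
          · rw [if_neg hv, zero_add]
            simp only [hA, mem_filter, mem_univ, true_and, not_le] at hv
            exact_mod_cast hv.le
      _ = _ := by simp [sum_add_distrib, hn]
  have hlow : (m : ℝ) * (d * n) ≤ ∑ j, (#(N j) : ℝ) := by
    calc (m : ℝ) * (d * n) = ∑ _j : Fin m, d * (n : ℝ) := by simp
      _ ≤ _ := sum_le_sum fun j _ => hN j
  have hAcard : d / 2 * n ≤ #A := by
    have hn0 : (0 : ℝ) ≤ n := by positivity
    have : (m : ℝ) * (d / 2 * n) ≤ m * #A := by nlinarith
    exact le_of_mul_le_mul_left this hm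
  -- Off `A` the index set is a dummy; the pigeonhole runs over `A` only.
  have hsub : ∀ v, ∃ S : Finset (Fin m), #S = s ∧ (v ∈ A → ∀ j ∈ S, v ∈ N j) := by
    intro v
    by_cases hv : v ∈ A
    · obtain ⟨S, hS, hc⟩ := exists_subset_card_eq (mem_filter.1 hv).2
      exact ⟨S, hc, fun _ j hj => (mem_filter.1 (hS hj)).2⟩
    · obtain ⟨S, -, hc⟩ := exists_subset_card_eq
        (s := (univ : Finset (Fin m))) (n := s) (by simpa using hsm)
      exact ⟨S, hc, fun h => absurd h hv⟩
  choose S hScard hS using hsub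
  obtain ⟨Y, hY, hYc⟩ := exists_le_card_fiber_of_nsmul_le_card_of_maps_to
    (s := A) (t := (univ : Finset (Fin m)).powersetCard s) (f := S)
    (b := d / 2 * (n : ℝ) / 2 ^ m) (fun v _ => mem_powersetCard.2 ⟨subset_univ _, hScard v⟩)
    (powersetCard_nonempty.2 (by simpa using hsm)) (by
      have h1 : #((univ : Finset (Fin m)).powersetCard s) ≤ 2 ^ m := by
        rw [card_powersetCard, card_univ, Fintype.card_fin]
        exact Nat.choose_le_two_pow m s
      have h1' : (#((univ : Finset (Fin m)).powersetCard s) : ℝ) ≤ 2 ^ m := by exact_mod_cast h1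
      have hd0 : 0 ≤ d := by
        by_contra h
        nlinarith
      rw [nsmul_eq_mul]
      calc _ ≤ (2 : ℝ) ^ m * (d / 2 * (n : ℝ) / 2 ^ m) := by gcongr
        _ = d / 2 * n := by field_simp
        _ ≤ _ := hAcard)
  refine ⟨Y, {v ∈ A | S v = Y}, (mem_powersetCard.1 hY).2, fun v hv j hj => ?_, ?_⟩
  · obtain ⟨hvA, rfl⟩ := mem_filter.1 hv
    exact hS v hvA j hj
  · rwa [div_le_iff₀ (by positivity)] at hYc

/-- The entries of the tuples `a j` form the classes of a complete multipartite subgraph. -/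
def IsBlowup (G : SimpleGraph V) {k s : ℕ} (a : Fin s → Fin k → V) : Prop :=
  (∀ i, Function.Injective fun j => a j i) ∧
    ∀ i i', i ≠ i' → ∀ j j', G.Adj (a j i) (a j' i')

variable (G : SimpleGraph V)

/-- Tuples with fewer than `d n` extensions account for at most `d n ^ (k + 2)` members of `M`, so
dropping the last entry costs one `d` of density; this is why the density has the form `(k + 2) d`.
The blowup of the shorter tuples has `D s` rows, of which `s` are kept that share a large set `T` of
extensions. Keeping all of `T` here lets it serve either as an ordinary class or as the large one.
-/
theorem exists_blowup_extend {d : ℝ} (hd : 0 < d) (hd1 : d ≤ 1) {D : ℕ} (hD : 2 ≤ D * d)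
    {k s : ℕ} (hs : 0 < s) (hn : 0 < Fintype.card V)
    (ih : ∀ M : Finset (Fin (k + 1) → V), (∀ x ∈ M, IsCliqueTuple G x) →
      ((k : ℝ) + 1) * d * (Fintype.card V : ℝ) ^ (k + 1) ≤ #M →
      ∃ a : Fin (D * s) → Fin (k + 1) → V, (∀ j, a j ∈ M) ∧ IsBlowup G a)
    (M : Finset (Fin (k + 2) → V)) (hM : ∀ x ∈ M, IsCliqueTuple G x)
    (hMc : ((k : ℝ) + 2) * d * (Fintype.card V : ℝ) ^ (k + 2) ≤ #M) :
    ∃ (a : Fin s → Fin (k + 1) → V) (T : Finset V), IsBlowup G a ∧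
      (∀ j, ∀ v ∈ T, (Fin.last (k + 1)).insertNth (α := fun _ => V) v (a j) ∈ M) ∧
      d / 2 * Fintype.card V ≤ #T * 2 ^ (D * s) := by
  set n := Fintype.card V with hn'
  have hnR : (0 : ℝ) < n := by exact_mod_cast hn
  let E : (Fin (k + 1) → V) → Finset V := fun x =>
    {v | (Fin.last (k + 1)).insertNth (α := fun _ => V) v x ∈ M}
  set M' : Finset (Fin (k + 1) → V) := {x | d * n ≤ #(E x)} with hM'
  have hcard : (#M : ℝ) = ∑ x : Fin (k + 1) → V, (#(E x) : ℝ) := by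
    have h := sum_insertNth (V := V) (Fin.last (k + 1)) fun x => if x ∈ M then (1 : ℝ) else 0
    simp only [sum_boole, filter_univ_mem] at h
    exact h
  have hup : ∑ x : Fin (k + 1) → V, (#(E x) : ℝ) ≤ #M' * n + (n : ℝ) ^ (k + 1) * (d * n) := by
    calc _ ≤ ∑ x : Fin (k + 1) → V, ((if x ∈ M' then (n : ℝ) else 0) + d * n) := by
          refine sum_le_sum fun x _ => ?_
          by_cases hx : x ∈ M'
          · rw [if_pos hx]
            have : (#(E x) : ℝ) ≤ n := by exact_mod_cast card_le_univ _
            have : 0 ≤ d * n := by positivity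
            linarith
          · rw [if_neg hx, zero_add]
            simp only [hM', mem_filter, mem_univ, true_and, not_le] at hx
            exact hx.le
      _ = _ := by simp [sum_add_distrib, hn']
  have hM'c : ((k : ℝ) + 1) * d * (n : ℝ) ^ (k + 1) ≤ #M' := by
    refine le_of_mul_le_mul_right (a := (n : ℝ)) ?_ hnR
    have : ((k : ℝ) + 1) * d * (n : ℝ) ^ (k + 1) * n =
        ((k : ℝ) + 2) * d * (n : ℝ) ^ (k + 2) - (n : ℝ) ^ (k + 1) * (d * n) := by ring
    linarith
  obtain ⟨a, haM, hinj, hadj⟩ := ih M' (fun x hx => by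
    have hx' : d * n ≤ #(E x) := (mem_filter.1 hx).2
    have : 0 < #(E x) := by
      have : (0 : ℝ) < #(E x) := lt_of_lt_of_le (by positivity) hx'
      exact_mod_cast this
    obtain ⟨v, hv⟩ := card_pos.1 this
    exact ((isCliqueTuple_insertNth G _ v x).1 (hM _ (mem_filter.1 hv).2)).2) hM'c
  obtain ⟨S, T, hSc, hST, hT⟩ := exists_common_subset hs (d := d) (m := D * s)
    (by push_cast; nlinarith [(Nat.cast_pos (α := ℝ)).2 hs]) hd1 (fun j => E (a j))
    (fun j => (mem_filter.1 (haM j)).2)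
  let f := S.orderEmbOfFin hSc
  refine ⟨fun j => a (f j), T, ⟨fun i j j' h => f.injective (hinj i h),
    fun i i' hii j j' => hadj i i' hii _ _⟩, fun j v hv => ?_, hT⟩
  exact (mem_filter.1 (hST v hv _ (S.orderEmbOfFin_mem hSc j))).2

/-- Every level multiplies the number of rows needed below by `D`, so the bottom level needs `D ^ k
* s`. The power of 4 pays for the pigeonhole loss `2 ^ m` together with the `s ≤ m` vertices still
required, via `2 ^ m * m ≤ 4 ^ m`. -/
theorem exists_blowup {d : ℝ} (hd : 0 < d) (hd1 : d ≤ 1) {D : ℕ} (hD : 2 ≤ D * d) (k : ℕ) :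
    ∀ s : ℕ, 0 < s → (4 : ℝ) ^ (D ^ k * s) * (2 / d) ≤ Fintype.card V →
    ∀ M : Finset (Fin (k + 1) → V), (∀ x ∈ M, IsCliqueTuple G x) →
      ((k : ℝ) + 1) * d * (Fintype.card V : ℝ) ^ (k + 1) ≤ #M →
      ∃ a : Fin s → Fin (k + 1) → V, (∀ j, a j ∈ M) ∧ IsBlowup G a := by
  have hD1 : 1 ≤ D := by
    rcases Nat.eq_zero_or_pos D with rfl | h
    · norm_num at hD
    · exact h
  have h2d : 0 < 2 / d := by positivity
  have hbound : ∀ m : ℕ, (2 : ℝ) ^ m * m ≤ 4 ^ m := by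
    intro m
    have h : (m : ℝ) ≤ 2 ^ m := by exact_mod_cast Nat.lt_two_pow_self.le
    calc (2 : ℝ) ^ m * m ≤ 2 ^ m * 2 ^ m := by gcongr
      _ = 4 ^ m := by rw [← mul_pow]; norm_num
  induction k with
  | zero =>
    intro s hs hn M hM hMc
    simp only [CharP.cast_eq_zero, zero_add, one_mul, pow_one, pow_zero] at hMc hn
    have hsM : s ≤ #M := by
      have h1 : (s : ℝ) ≤ 2 ^ s * s :=
        le_mul_of_one_le_left (by positivity) (one_le_pow₀ (by norm_num))
      have h2 : (4 : ℝ) ^ s ≤ d / 2 * Fintype.card V := by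
        have := mul_le_mul_of_nonneg_left hn (by positivity : 0 ≤ d / 2)
        calc (4 : ℝ) ^ s = d / 2 * (4 ^ s * (2 / d)) := by field_simp
          _ ≤ _ := this
      have h3 : d / 2 * Fintype.card V ≤ d * Fintype.card V := by gcongr; linarith
      have : (s : ℝ) ≤ #M := by linarith [hbound s]
      exact_mod_cast this
    obtain ⟨S, hSM, hSc⟩ := exists_subset_card_eq hsM
    let e := S.equivFinOfCardEq hSc
    refine ⟨fun j => (e.symm j : Fin 1 → V), fun j => hSM (e.symm j).2, fun i j j' h => ?_,
      fun i i' hii => absurd (Fin.ext (by omega)) hii⟩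
    refine e.symm.injective (Subtype.ext (funext fun l => ?_))
    rw [show l = i from Fin.ext (by omega)]
    exact h
  | succ k ih =>
    intro s hs hn M hM hMc
    have hn0 : 0 < Fintype.card V := by
      have : (0 : ℝ) < Fintype.card V := lt_of_lt_of_le (by positivity) hn
      exact_mod_cast this
    obtain ⟨a, T, ⟨hinj, hadj⟩, haT, hT⟩ := exists_blowup_extend G hd hd1 hD hs hn0
      (ih (D * s) (by positivity) (by rwa [← mul_assoc, ← pow_succ])) M hM
      (by push_cast at hMc; rwa [add_assoc, one_add_one_eq_two] at hMc)
    have hsT : s ≤ #T := by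
      have h1 : (4 : ℝ) ^ (D * s) ≤ d / 2 * Fintype.card V := by
        have hle : D * s ≤ D ^ (k + 1) * s := Nat.mul_le_mul_right _ (Nat.le_self_pow (by omega) D)
        calc (4 : ℝ) ^ (D * s) ≤ 4 ^ (D ^ (k + 1) * s) := pow_le_pow_right₀ (by norm_num) hle
          _ = d / 2 * (4 ^ (D ^ (k + 1) * s) * (2 / d)) := by field_simp
          _ ≤ _ := by gcongr
      have h2 : (2 : ℝ) ^ (D * s) * s ≤ 2 ^ (D * s) * #T := by
        calc (2 : ℝ) ^ (D * s) * s ≤ 2 ^ (D * s) * (D * s : ℕ) := by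
              gcongr
              exact Nat.le_mul_of_pos_left s hD1
          _ ≤ 4 ^ (D * s) := hbound _
          _ ≤ _ := by linarith
      have : (s : ℝ) ≤ #T := le_of_mul_le_mul_left h2 (by positivity)
      exact_mod_cast this
    obtain ⟨S, hST, hSc⟩ := exists_subset_card_eq hsT
    let e := S.equivFinOfCardEq hSc
    have hv : ∀ j, (e.symm j : V) ∈ T := fun j => hST (e.symm j).2
    have hav : ∀ j j' i, G.Adj (e.symm j : V) (a j' i) := fun j j' i =>
      ((isCliqueTuple_insertNth G _ _ _).1 (hM _ (haT j' _ (hv j)))).1 i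
    refine ⟨fun j => (Fin.last (k + 1)).insertNth (α := fun _ => V) (e.symm j : V) (a j),
      fun j => haT j _ (hv j), fun i j j' h => ?_, fun i i' hii j j' => ?_⟩
    · rcases Fin.eq_self_or_eq_succAbove (Fin.last (k + 1)) i with rfl | ⟨l, rfl⟩
      · simp only [Fin.insertNth_apply_same] at h
        exact e.symm.injective (Subtype.ext h)
      · simp only [Fin.insertNth_apply_succAbove] at h
        exact hinj l h
    · rcases Fin.eq_self_or_eq_succAbove (Fin.last (k + 1)) i with rfl | ⟨l, rfl⟩
      · rcases Fin.eq_self_or_eq_succAbove (Fin.last (k + 1)) i' with rfl | ⟨l', rfl⟩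
        · exact absurd rfl hii
        · simpa only [Fin.insertNth_apply_same, Fin.insertNth_apply_succAbove] using hav j j' l'
      · rcases Fin.eq_self_or_eq_succAbove (Fin.last (k + 1)) i' with rfl | ⟨l', rfl⟩
        · simpa only [Fin.insertNth_apply_same, Fin.insertNth_apply_succAbove] using
            (hav j' j l).symm
        · simpa only [Fin.insertNth_apply_succAbove] using
            hadj l l' (fun e => hii (by rw [e])) j j'

omit [Fintype V] in
theorem completeMultipartiteGraph_isContained {ι : Type*} {size : ι → ℕ} (C : ι → Finset V)
    (hC : ∀ i, size i ≤ #(C i))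
    (hadj : ∀ i i', i ≠ i' → ∀ u ∈ C i, ∀ v ∈ C i', G.Adj u v) :
    SimpleGraph.completeMultipartiteGraph (fun i => Fin (size i)) ⊑ G := by
  have hf : ∀ i, Nonempty (Fin (size i) ↪ C i) := fun i =>
    Function.Embedding.nonempty_of_card_le (by simpa using hC i)
  let f := fun i => (hf i).some
  refine ⟨⟨⟨fun p => (f p.1 p.2 : V), fun {p q} hpq => ?_⟩, ?_⟩⟩
  · exact hadj _ _ hpq _ (f p.1 p.2).2 _ (f q.1 q.2).2
  · rintro ⟨i, x⟩ ⟨i', x'⟩ h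
    by_cases hii : i = i'
    · subst hii
      exact congrArg _ ((f i).injective (Subtype.ext h))
    · exact absurd h (hadj i i' hii _ (f i x).2 _ (f i' x').2).ne

/-- One last extension, using `T` whole as the large class. The extra `2 ^ (D * s)` in `ht` leaves
room for `t` to be a ceiling. -/
theorem completePartiteOneLarge_isContained {d : ℝ} (hd : 0 < d) (hd1 : d ≤ 1) {D : ℕ}
    (hD : 2 ≤ D * d) {k s t : ℕ} (hs : 0 < s)
    (hn : (4 : ℝ) ^ (D ^ (k + 1) * s) * (2 / d) ≤ Fintype.card V)
    (ht : (t : ℝ) * 2 ^ (D * s) < d / 2 * Fintype.card V + 2 ^ (D * s))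
    (M : Finset (Fin (k + 2) → V)) (hM : ∀ x ∈ M, IsCliqueTuple G x)
    (hMc : ((k : ℝ) + 2) * d * (Fintype.card V : ℝ) ^ (k + 2) ≤ #M) :
    completePartiteOneLarge (k + 2) s t ⊑ G := by
  have hn0 : 0 < Fintype.card V := by
    have : (0 : ℝ) < Fintype.card V := lt_of_lt_of_le (by positivity) hn
    exact_mod_cast this
  have hD1 : 0 < D := by
    rcases Nat.eq_zero_or_pos D with rfl | h
    · norm_num at hD
    · exact h
  obtain ⟨a, T, ⟨hinj, hadj⟩, haT, hT⟩ := exists_blowup_extend G hd hd1 hD hs hn0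
    (exists_blowup G hd hd1 hD k (D * s) (by positivity) (by rwa [← mul_assoc, ← pow_succ]))
    M hM hMc
  have htT : t ≤ #T := by
    have h : (t : ℝ) * 2 ^ (D * s) < (#T + 1 : ℝ) * 2 ^ (D * s) := by linarith
    have h' : (t : ℝ) < #T + 1 := lt_of_mul_lt_mul_right h (by positivity)
    exact Nat.lt_succ_iff.1 (by exact_mod_cast h')
  have hav : ∀ v ∈ T, ∀ j i, G.Adj v (a j i) := fun v hv j i =>
    ((isCliqueTuple_insertNth G _ _ _).1 (hM _ (haT j _ hv))).1 i
  refine completeMultipartiteGraph_isContained G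
    ((Fin.last (k + 1)).insertNth (α := fun _ => Finset V) T
      fun i => univ.image fun j => a j i) (fun i => ?_) fun i i' hii u hu v hv => ?_
  · rcases Fin.eq_self_or_eq_succAbove (Fin.last (k + 1)) i with rfl | ⟨l, rfl⟩
    · simpa using htT
    · have : ((Fin.last (k + 1)).succAbove l : ℕ) + 1 ≠ k + 2 := by
        simp [Fin.succAbove_last]
        omega
      rw [if_neg this, Fin.insertNth_apply_succAbove, card_image_of_injective _ (hinj l)]
      simp
  · rcases Fin.eq_self_or_eq_succAbove (Fin.last (k + 1)) i with rfl | ⟨l, rfl⟩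
    · rcases Fin.eq_self_or_eq_succAbove (Fin.last (k + 1)) i' with rfl | ⟨l', rfl⟩
      · exact absurd rfl hii
      · rw [Fin.insertNth_apply_same] at hu
        simp only [Fin.insertNth_apply_succAbove, mem_image, mem_univ, true_and] at hv
        obtain ⟨j, rfl⟩ := hv
        exact hav u hu j l'
    · simp only [Fin.insertNth_apply_succAbove, mem_image, mem_univ, true_and] at hu
      obtain ⟨j, rfl⟩ := hu
      rcases Fin.eq_self_or_eq_succAbove (Fin.last (k + 1)) i' with rfl | ⟨l', rfl⟩
      · rw [Fin.insertNth_apply_same] at hv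
        exact (hav v hv j l).symm
      · simp only [Fin.insertNth_apply_succAbove, mem_image, mem_univ, true_and] at hv
        obtain ⟨j', rfl⟩ := hv
        exact hadj l l' (fun e => hii (by rw [e])) j j'

end Blowup

/-! ### From the spectral radius to the number of edges -/

section Spectral

open Classical Finset

variable {V : Type*} [Fintype V]

/-- The number of ordered pairs of adjacent vertices. -/
noncomputable def adjPairs (G : SimpleGraph V) : Finset (V × V) := {p | G.Adj p.1 p.2}

variable (G : SimpleGraph V)

theorem cliqueWeight_le {y : V → ℝ} (hy : ∀ v, 0 ≤ y v) {B : ℝ} (hB : ∀ v, y v ≤ B) (k : ℕ) :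
    cliqueWeight G y k ≤ #{x : Fin k → V | IsCliqueTuple G x} * B ^ k := by
  rw [← nsmul_eq_mul, ← sum_const, sum_filter]
  refine sum_le_sum fun x _ => ?_
  unfold tupleWeight
  split_ifs
  · calc ∏ i, y (x i) ≤ ∏ _i : Fin k, B := prod_le_prod (fun i _ => hy _) fun i _ => hB _
      _ = B ^ k := by simp
  · exact le_rfl

theorem cliqueWeight_const (b : ℝ) (k : ℕ) :
    cliqueWeight G (fun _ => b) k = #{x : Fin k → V | IsCliqueTuple G x} * b ^ k := by
  rw [← nsmul_eq_mul, ← sum_const, sum_filter]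
  refine sum_congr rfl fun x _ => ?_
  unfold tupleWeight
  simp

theorem cliqueWeight_two_const (b : ℝ) :
    cliqueWeight G (fun _ => b) 2 = #(adjPairs G) * b ^ 2 := by
  rw [cliqueWeight_two, ← Fintype.sum_prod_type' (f := fun u v => if G.Adj u v then b * b else 0),
    ← sum_filter, sum_const, nsmul_eq_mul, pow_two]
  rfl

theorem exists_adjMatrix_eigenvector [Nonempty V] :
    ∃ v : V → ℝ, v ≠ 0 ∧
      ∀ i, graphSpectralRadius G * v i = ∑ j, if G.Adj i j then v j else 0 := by
  have h := (isGreatest_graphSpectralRadius G).1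
  rw [← Matrix.spectrum_toLin', ← Module.End.hasEigenvalue_iff_mem_spectrum] at h
  obtain ⟨v, hv⟩ := h.exists_hasEigenvector
  refine ⟨v, hv.2, fun i => ?_⟩
  have := congrFun hv.apply_eq_smul i
  rw [Matrix.toLin'_apply, Pi.smul_apply, smul_eq_mul] at this
  rw [← this, Matrix.mulVec, dotProduct]
  exact sum_congr rfl fun j _ => by simp [SimpleGraph.adjMatrix_apply]

/-- The weights are the normalised squares of an eigenvector, so its signs do not matter.
Cauchy–Schwarz on a single eigenvalue equation bounds each weight; Cauchy–Schwarz on the quadratic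
form over adjacent pairs gives the last claim. -/
theorem exists_weight_of_spectralRadius [Nonempty V] {m : ℝ} (hm0 : 0 < m)
    (hm : m ≤ graphSpectralRadius G) :
    ∃ y : V → ℝ, (∀ v, 0 ≤ y v) ∧ ∑ v, y v = 1 ∧ (∀ v, y v ≤ Fintype.card V / m ^ 2) ∧
      m ^ 2 ≤ #(adjPairs G) * cliqueWeight G y 2 := by
  obtain ⟨v, hv0, hv⟩ := exists_adjMatrix_eigenvector G
  set μ := graphSpectralRadius G
  set S := ∑ i, v i ^ 2 with hS
  have hS0 : 0 < S := by
    refine lt_of_le_of_ne (sum_nonneg fun i _ => sq_nonneg _) fun h => hv0 (funext fun i => ?_)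
    have := (sum_eq_zero_iff_of_nonneg fun i _ => sq_nonneg (v i)).1 h.symm i (mem_univ i)
    simpa using this
  have hm2 : m ^ 2 ≤ μ ^ 2 := by gcongr
  refine ⟨fun i => v i ^ 2 / S, fun i => by positivity, ?_, fun i => ?_, ?_⟩
  · rw [← sum_div, div_self hS0.ne']
  · rw [div_le_div_iff₀ hS0 (by positivity)]
    calc v i ^ 2 * m ^ 2 ≤ v i ^ 2 * μ ^ 2 := by gcongr
      _ = (∑ j, 1 * if G.Adj i j then v j else 0) ^ 2 := by simp_rw [one_mul, ← hv i]; ring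
      _ ≤ (∑ _j : V, (1 : ℝ) ^ 2) * ∑ j, (if G.Adj i j then v j else 0) ^ 2 :=
          sum_mul_sq_le_sq_mul_sq _ _ _
      _ ≤ Fintype.card V * S := by
          have : ∑ j, (if G.Adj i j then v j else 0) ^ 2 ≤ S := by
            refine sum_le_sum fun j _ => ?_
            split_ifs
            · exact le_rfl
            · simpa using sq_nonneg (v j)
          simp only [one_pow, sum_const, card_univ, nsmul_eq_mul, mul_one]
          gcongr
  · have h1 : μ * S = ∑ p ∈ adjPairs G, 1 * (v p.1 * v p.2) := by
      rw [hS, mul_sum, adjPairs, sum_filter, Fintype.sum_prod_type]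
      refine sum_congr rfl fun i _ => ?_
      rw [pow_two, ← mul_assoc, hv i, sum_mul]
      exact sum_congr rfl fun j _ => by split_ifs <;> ring
    have h2 : cliqueWeight G (fun i => v i ^ 2 / S) 2 * S ^ 2 =
        ∑ p ∈ adjPairs G, (v p.1 * v p.2) ^ 2 := by
      rw [cliqueWeight_two, sum_mul, adjPairs, sum_filter, Fintype.sum_prod_type]
      refine sum_congr rfl fun i _ => ?_
      rw [sum_mul]
      refine sum_congr rfl fun j _ => ?_
      split_ifs
      · field_simp
      · ring
    have h3 := sum_mul_sq_le_sq_mul_sq (adjPairs G) (fun _ => (1 : ℝ)) fun p => v p.1 * v p.2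
    rw [← h1, ← h2] at h3
    simp only [one_pow, sum_const, nsmul_eq_mul, mul_one] at h3
    have hS2 : 0 < S ^ 2 := by positivity
    refine le_of_mul_le_mul_right ?_ hS2
    calc m ^ 2 * S ^ 2 ≤ μ ^ 2 * S ^ 2 := by gcongr
      _ = (μ * S) ^ 2 := by ring
      _ ≤ _ := by rw [mul_assoc]; exact h3

/-- A Motzkin–Straus bound allowing for a few `(r + 1)`-cliques. -/
theorem cliqueWeight_two_le {y : V → ℝ} (hy : ∀ v, 0 ≤ y v) (h1 : ∑ v, y v = 1) {r : ℕ}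
    (hr : 2 ≤ r) :
    cliqueWeight G y 2 ≤ 1 - 1 / r + (2 * (r : ℝ)) ^ r * cliqueWeight G y (r + 1) := by
  have hr0 : (0 : ℝ) < r := by positivity
  have hnn := cliqueWeight_nonneg G hy (r + 1)
  by_contra! h
  have hpos : 0 ≤ (2 * (r : ℝ)) ^ r * cliqueWeight G y (r + 1) := by positivity
  obtain ⟨k, rfl⟩ : ∃ k, r = k + 1 := ⟨r - 1, by omega⟩
  -- Here `a = -δ`, with `δ > 0` the excess of `q_2` over `1 - 1/r`. At the last index the ratio
  -- bound becomes `r δ`, so `(2r) ^ r * q_(r+1) ≥ 2 r² δ`, contradicting the assumption that the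
  -- left side is below `δ`.
  obtain ⟨hp, hge⟩ := cliqueWeight_succ_ge G hy h1 hr (a := 1 - 1 / ((k + 1 : ℕ) : ℝ) -
    cliqueWeight G y 2) (by
      have : (0 : ℝ) ≤ 1 / (2 * ((k + 1 : ℕ) : ℝ) ^ 2) := by positivity
      linarith) (by linarith) k le_rfl
  set δ := cliqueWeight G y 2 - (1 - 1 / ((k + 1 : ℕ) : ℝ)) with hδ
  rw [show k + 1 + 1 = k + 2 from rfl] at *
  set p := cliqueWeight G y (k + 1)
  set q := cliqueWeight G y (k + 2)
  push_cast at *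
  have e : (1 - ((k : ℝ) + 1) / (k + 1) - (k + 1) * (1 - 1 / ((k : ℝ) + 1) -
      cliqueWeight G y 2)) = (k + 1) * δ := by
    rw [hδ, div_self hr0.ne']
    ring
  rw [e] at hge
  have hδ0 : (2 * ((k : ℝ) + 1)) ^ (k + 1) * q < δ := by rw [hδ]; linarith
  have hδpos : 0 < δ := lt_of_le_of_lt hpos hδ0
  have h4 : (k + 1) * δ * (1 / (2 * ((k : ℝ) + 1))) ^ k ≤ q := by
    refine le_trans ?_ hge
    gcongr
  have h5 : (2 * ((k : ℝ) + 1)) ^ (k + 1) * ((k + 1) * δ * (1 / (2 * ((k : ℝ) + 1))) ^ k) =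
      2 * (k + 1) ^ 2 * δ := by
    have : (2 * ((k : ℝ) + 1)) ^ k * (1 / (2 * ((k : ℝ) + 1))) ^ k = 1 := by
      rw [← mul_pow, mul_one_div, div_self (by positivity), one_pow]
    calc _ = 2 * ((k : ℝ) + 1) ^ 2 * δ *
          ((2 * ((k : ℝ) + 1)) ^ k * (1 / (2 * ((k : ℝ) + 1))) ^ k) := by ring
      _ = _ := by rw [this, mul_one]
  have h6 : (2 * ((k : ℝ) + 1)) ^ (k + 1) * ((k + 1) * δ * (1 / (2 * ((k : ℝ) + 1))) ^ k) ≤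
      (2 * ((k : ℝ) + 1)) ^ (k + 1) * q := by gcongr
  rw [h5] at h6
  have : (1 : ℝ) ≤ 2 * (k + 1) ^ 2 := by
    have : (0 : ℝ) ≤ k := by positivity
    nlinarith
  nlinarith

/-- A graph with large spectral radius and few `(r + 1)`-cliques has many edges. -/
theorem card_adjPairs_ge_of_spectralRadius [Nonempty V] {r : ℕ} (hr : 2 ≤ r) {ε β δ : ℝ}
    (hε0 : 0 ≤ ε) (hε : ε ≤ 1 / 20)
    (hμ : (1 - 1 / (r : ℝ) - ε) * Fintype.card V ≤ graphSpectralRadius G)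
    (hβ : (#{x : Fin (r + 1) → V | IsCliqueTuple G x} : ℝ) ≤ β * (Fintype.card V : ℝ) ^ (r + 1))
    (hδ : (2 * (r : ℝ)) ^ r * (5 ^ (r + 1) * β) ≤ δ) (hδ0 : 0 ≤ δ) :
    (1 - 1 / (r : ℝ) - (2 * ε + δ)) * (Fintype.card V : ℝ) ^ 2 ≤ #(adjPairs G) := by
  set n := (Fintype.card V : ℝ) with hn
  have hn0 : 0 < n := Nat.cast_pos.2 Fintype.card_pos
  have hr2 : (2 : ℝ) ≤ r := by exact_mod_cast hr
  have hr' : 1 / (r : ℝ) ≤ 1 / 2 := one_div_le_one_div_of_le (by norm_num) hr2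
  set θ := 1 - 1 / (r : ℝ)
  have hθ : 9 / 20 ≤ θ - ε := by simp only [θ]; linarith
  obtain ⟨y, hy0, hy1, hyB, hy⟩ := exists_weight_of_spectralRadius G
    (m := (θ - ε) * n) (by positivity) hμ
  -- `(9/20)² ≥ 1/5`. As no weight exceeds `5 / n`, few cliques in number means little clique
  -- weight.
  have hyB' : ∀ v, y v ≤ 5 / n := fun v => (hyB v).trans (by
    rw [← hn, div_le_div_iff₀ (by positivity) hn0]
    have : 1 / 5 ≤ (θ - ε) ^ 2 := by nlinarith
    have := mul_le_mul_of_nonneg_right this (by positivity : 0 ≤ n ^ 2)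
    nlinarith)
  have hp2 : cliqueWeight G y 2 ≤ θ + δ := by
    refine (cliqueWeight_two_le G hy0 hy1 hr).trans ?_
    have h1 : cliqueWeight G y (r + 1) ≤ 5 ^ (r + 1) * β := by
      calc cliqueWeight G y (r + 1) ≤ _ := cliqueWeight_le G hy0 hyB' (r + 1)
        _ ≤ β * n ^ (r + 1) * (5 / n) ^ (r + 1) := by gcongr
        _ = 5 ^ (r + 1) * β := by rw [div_pow]; field_simp
    have h2 := mul_le_mul_of_nonneg_left h1 (by positivity : 0 ≤ (2 * (r : ℝ)) ^ r)
    linarith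
  have hA : ((θ - ε) * n) ^ 2 ≤ #(adjPairs G) * (θ + δ) := hy.trans (by gcongr)
  have hθδ : 0 < θ + δ := by linarith
  refine le_of_mul_le_mul_right (le_trans ?_ hA) hθδ
  have : (θ - (2 * ε + δ)) * (θ + δ) ≤ (θ - ε) ^ 2 := by nlinarith [mul_nonneg hε0 hδ0]
  have := mul_le_mul_of_nonneg_right this (by positivity : 0 ≤ n ^ 2)
  nlinarith

end Spectral

/-! ### Choosing a good clique by averaging -/

section CliqueAveraging

open Classical Finset

variable {V : Type*} [Fintype V] (G : SimpleGraph V) {y : V → ℝ}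

/-- The total weight of the ordered adjacent pairs inside the parts defined by `x`. -/
noncomputable def insideWeight (y : V → ℝ) {k : ℕ} (x : Fin k → V) : ℝ :=
  ∑ i, ∑ u ∈ cliquePart G x i, ∑ w ∈ cliquePart G x i, if G.Adj u w then y u * y w else 0

/-- An edge inside the `i`-th part, together with `x` stripped of its `i`-th entry, is a `(k +
2)`-clique. The stripped entry then ranges freely, with total weight at most 1. -/
theorem sum_tupleWeight_mul_insideWeight_le (hy : ∀ v, 0 ≤ y v) (h1 : ∑ v, y v = 1) (k : ℕ) :
    ∑ x : Fin (k + 1) → V, tupleWeight G y x * insideWeight G y x ≤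
      ((k : ℝ) + 1) * cliqueWeight G y (k + 2) := by
  unfold insideWeight
  simp_rw [mul_sum (s := (univ : Finset (Fin (k + 1))))]
  rw [sum_comm]
  have key : ∀ i : Fin (k + 1), ∑ x : Fin (k + 1) → V, tupleWeight G y x *
      ∑ u ∈ cliquePart G x i, ∑ w ∈ cliquePart G x i, (if G.Adj u w then y u * y w else 0) ≤
      cliqueWeight G y (k + 2) := by
    intro i
    rw [sum_insertNth i, cliqueWeight_succ, sum_insertNth 0]
    refine sum_le_sum fun x _ => ?_
    have hpair : ∀ v, ∑ u ∈ cliquePart G (i.insertNth (α := fun _ => V) v x) i,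
        ∑ w ∈ cliquePart G (i.insertNth (α := fun _ => V) v x) i,
          (if G.Adj u w then y u * y w else 0) ≤
        ∑ w, joinWeight G y x w *
          ∑ u, joinWeight G y ((0 : Fin (k + 1)).insertNth (α := fun _ => V) w x) u := by
      intro v
      simp_rw [mul_sum]
      rw [sum_comm (s := (univ : Finset V))]
      rw [← sum_filter_add_sum_filter_not univ
        (· ∈ cliquePart G (i.insertNth (α := fun _ => V) v x) i)]
      have hnn : ∀ u w : V, 0 ≤ joinWeight G y x w *
          joinWeight G y ((0 : Fin (k + 1)).insertNth (α := fun _ => V) w x) u := fun u w =>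
        mul_nonneg (joinWeight_nonneg G hy _ _) (joinWeight_nonneg G hy _ _)
      refine le_add_of_le_of_nonneg ?_ (sum_nonneg fun u _ => sum_nonneg fun w _ => hnn u w)
      rw [filter_univ_mem]
      refine sum_le_sum fun u hu => ?_
      refine le_trans (sum_le_sum fun w hw => ?_)
        (sum_le_sum_of_subset_of_nonneg (subset_univ _) fun w _ _ => hnn u w)
      split_ifs with huw
      · have hj : ∀ z ∈ cliquePart G (i.insertNth (α := fun _ => V) v x) i,
            ∀ j, G.Adj z (x j) := fun z hz j => by
          have := (mem_filter.1 hz).2.2 _ (Fin.succAbove_ne i j)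
          rwa [Fin.insertNth_apply_succAbove] at this
        have hu' : ∀ j, G.Adj u ((0 : Fin (k + 1)).insertNth (α := fun _ => V) w x j) := by
          intro j
          rcases Fin.eq_self_or_eq_succAbove 0 j with rfl | ⟨l, rfl⟩
          · rwa [Fin.insertNth_apply_same]
          · rw [Fin.insertNth_apply_succAbove]
            exact hj u hu l
        rw [joinWeight, joinWeight, if_pos (hj w hw), if_pos hu', mul_comm]
      · exact hnn u w
    have htw := tupleWeight_nonneg G hy x
    have hjw := fun v => joinWeight_nonneg G hy x v
    calc _ ≤ ∑ v, y v * (tupleWeight G y x * ∑ w, joinWeight G y x w *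
          ∑ u, joinWeight G y ((0 : Fin (k + 1)).insertNth (α := fun _ => V) w x) u) := by
          refine sum_le_sum fun v _ => ?_
          rw [tupleWeight_insertNth, mul_assoc]
          have hle : joinWeight G y x v ≤ y v := by
            unfold joinWeight
            split_ifs
            · exact le_rfl
            · exact hy v
          have hin : 0 ≤ ∑ u ∈ cliquePart G (i.insertNth (α := fun _ => V) v x) i,
              ∑ w ∈ cliquePart G (i.insertNth (α := fun _ => V) v x) i,
                (if G.Adj u w then y u * y w else 0) :=
            sum_nonneg fun u _ => sum_nonneg fun w _ => by
              split_ifs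
              · exact mul_nonneg (hy _) (hy _)
              · exact le_rfl
          exact mul_le_mul hle (mul_le_mul_of_nonneg_left (hpair v) htw)
            (mul_nonneg htw hin) (hy v)
      _ = _ := by
          rw [← sum_mul, h1, one_mul, mul_sum]
          refine sum_congr rfl fun w _ => ?_
          rw [tupleWeight_insertNth]
          ring
  calc _ ≤ ∑ _i : Fin (k + 1), cliqueWeight G y (k + 2) := sum_le_sum fun i _ => key i
    _ = _ := by simp

/-- A clique whose parts cover almost everything and contain few edges. -/
theorem exists_clique_outside_inside_le (hy : ∀ v, 0 ≤ y v) (h1 : ∑ v, y v = 1) {k : ℕ}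
    (hk : 1 ≤ k) {a : ℝ} (ha : a ≤ 1 / (2 * ((k : ℝ) + 1) ^ 2))
    (h2 : 1 - 1 / ((k : ℝ) + 1) - a ≤ cliqueWeight G y 2) :
    ∃ x : Fin (k + 1) → V, IsCliqueTuple G x ∧
      3 * (∑ u ∈ cliqueOutside G x, y u) + insideWeight G y x ≤
        3 * ((k : ℝ) + 1) * k * a +
          4 * ((k : ℝ) + 1) * (2 * ((k : ℝ) + 1)) ^ k * cliqueWeight G y (k + 2) := by
  obtain ⟨l, rfl⟩ : ∃ l, k = l + 1 := ⟨k - 1, by omega⟩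
  have hr : 2 ≤ l + 1 + 1 := by omega
  have hcast : ((l + 1 + 1 : ℕ) : ℝ) = ((l + 1 : ℕ) : ℝ) + 1 := by push_cast; ring
  obtain ⟨hp, hge⟩ := cliqueWeight_succ_ge G hy h1 hr (a := a) (by rwa [hcast])
    (by rwa [hcast]) l (by omega)
  obtain ⟨hp', -⟩ := cliqueWeight_succ_ge G hy h1 hr (a := a) (by rwa [hcast])
    (by rwa [hcast]) (l + 1) le_rfl
  have hmm := moonMoser_outside G hy h1 (l + 1)
  have hin := sum_tupleWeight_mul_insideWeight_le G hy h1 (l + 1)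
  set k := l + 1
  rw [hcast] at *
  have hkR : ((l : ℝ) + 1) = k := by simp [k]
  rw [hkR] at hge
  rw [show l + 2 = k + 1 from rfl] at hge
  have hk0 : (0 : ℝ) < (k : ℝ) + 1 := by positivity
  have hP : 0 < cliqueWeight G y k := lt_of_lt_of_le (by positivity) hp
  have hQ : 0 < cliqueWeight G y (k + 1) := lt_of_lt_of_le (by positivity) hp'
  have hR0 := cliqueWeight_nonneg G hy (k + 2)
  set P := cliqueWeight G y k
  set R := cliqueWeight G y (k + 2)
  set O := ∑ x : Fin (k + 1) → V, tupleWeight G y x * ∑ u ∈ cliqueOutside G x, y u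
  -- The lower bound on `q_(k+1) / q_k` makes the squared term of `moonMoser_outside` cancel almost
  -- all of its right side, leaving little for `O`.
  have hO : O ≤ ((k : ℝ) + 1) * k * a * cliqueWeight G y (k + 1) + (k + 1) * R := by
    refine le_of_mul_le_mul_left ?_ hP
    have e : ((k : ℝ) + 1) * (1 - k / (k + 1) - k * a) = 1 - (k + 1) * k * a := by
      field_simp
      ring
    have := mul_le_mul_of_nonneg_left hge
      (by positivity : (0 : ℝ) ≤ (k + 1) * cliqueWeight G y (k + 1))
    have e' : ((k : ℝ) + 1) * cliqueWeight G y (k + 1) * ((1 - k / (k + 1) - k * a) * P) =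
        (1 - (k + 1) * k * a) * cliqueWeight G y (k + 1) * P := by rw [← e]; ring
    rw [e'] at this
    nlinarith
  set B := 3 * ((k : ℝ) + 1) * k * a + 4 * ((k : ℝ) + 1) * (2 * ((k : ℝ) + 1)) ^ k * R
  have hRQ : R ≤ (2 * ((k : ℝ) + 1)) ^ k * R * cliqueWeight G y (k + 1) := by
    have h := mul_le_mul_of_nonneg_left hp' (by positivity : 0 ≤ (2 * ((k : ℝ) + 1)) ^ k * R)
    have : (2 * ((k : ℝ) + 1)) ^ k * (1 / (2 * ((k : ℝ) + 1))) ^ k = 1 := by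
      rw [← mul_pow, mul_one_div, div_self (by positivity), one_pow]
    calc R = (2 * ((k : ℝ) + 1)) ^ k * (1 / (2 * ((k : ℝ) + 1))) ^ k * R := by
          rw [this, one_mul]
      _ = (2 * ((k : ℝ) + 1)) ^ k * R * (1 / (2 * ((k : ℝ) + 1))) ^ k := by ring
      _ ≤ _ := h
  have htot : ∑ x : Fin (k + 1) → V, tupleWeight G y x *
      (3 * (∑ u ∈ cliqueOutside G x, y u) + insideWeight G y x) ≤
      ∑ x : Fin (k + 1) → V, tupleWeight G y x * B := by
    rw [← sum_mul]
    calc _ = 3 * O + ∑ x : Fin (k + 1) → V, tupleWeight G y x * insideWeight G y x := by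
          simp only [mul_add, sum_add_distrib, O, mul_sum]
          congr 1
          exact sum_congr rfl fun x _ => sum_congr rfl fun u _ => by ring
      _ ≤ 3 * (((k : ℝ) + 1) * k * a * cliqueWeight G y (k + 1) + (k + 1) * R) +
          (k + 1) * R := by linarith
      _ ≤ cliqueWeight G y (k + 1) * B := by
          have := mul_le_mul_of_nonneg_left hRQ (by positivity : 0 ≤ 4 * ((k : ℝ) + 1))
          simp only [B]
          linarith
  -- If every clique exceeded `B`, so would the weighted average; strictness needs one clique of
  -- positive weight.
  by_contra! hcon
  refine absurd htot (not_le.2 (sum_lt_sum (fun x _ => ?_) ?_))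
  · by_cases hx : IsCliqueTuple G x
    · exact mul_le_mul_of_nonneg_left (hcon x hx).le (tupleWeight_nonneg G hy x)
    · simp [tupleWeight, hx]
  · obtain ⟨x, -, hx⟩ := exists_lt_of_sum_lt (s := (univ : Finset (Fin (k + 1) → V)))
      (f := fun _ => (0 : ℝ)) (g := fun x => tupleWeight G y x) (by rw [sum_const_zero]; exact hQ)
    have hxc : IsCliqueTuple G x := by
      by_contra h
      simp [tupleWeight, h] at hx
    exact ⟨x, mem_univ _, mul_lt_mul_of_pos_left (hcon x hxc) hx⟩

end CliqueAveraging

/-! ### From an almost-partition to the Turán graph -/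

section TuranDistance

open Classical Finset

theorem card_filter_mod_le {n r : ℕ} (i : Fin r) :
    #{x : Fin n | (x : ℕ) % r = i} ≤ n / r + 1 := by
  calc #{x : Fin n | (x : ℕ) % r = i} ≤ #(range (n / r + 1)) := by
        refine card_le_card_of_injOn (fun x => (x : ℕ) / r) (fun x _ => ?_) fun x hx x' hx' h => ?_
        · simp only [coe_range, Set.mem_Iio, Nat.lt_succ_iff]
          exact Nat.div_le_div_right x.2.le
        · simp only [coe_filter, mem_univ, true_and, Set.mem_ofPred_eq] at hx hx'
          refine Fin.ext ?_
          have h' : (x : ℕ) / r = x' / r := h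
          rw [← Nat.div_add_mod (x : ℕ) r, ← Nat.div_add_mod (x' : ℕ) r, hx, hx', h']
    _ = n / r + 1 := card_range _

theorem sum_card_filter_mod {n r : ℕ} (hr : 0 < r) :
    ∑ i : Fin r, #{x : Fin n | (x : ℕ) % r = i} = n := by
  have h := card_eq_sum_card_fiberwise (s := (univ : Finset (Fin n)))
    (t := (univ : Finset (Fin r))) (f := fun x : Fin n => (⟨(x : ℕ) % r, Nat.mod_lt _ hr⟩ : Fin r))
    (fun x _ => mem_coe.2 (mem_univ _))
  rw [card_univ, Fintype.card_fin] at h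
  refine Eq.trans (sum_congr rfl fun i _ => ?_) h.symm
  simp only [Fin.ext_iff]

variable {V : Type*} [Fintype V]

/-- Disjoint sets can be mapped into the residue classes by a bijection, with few exceptions. -/
theorem exists_equiv_card_exceptions_le {n r : ℕ} (hr : 0 < r) (hV : Fintype.card V = n)
    (C : Fin r → Finset V) (hC : ∀ i j, i ≠ j → Disjoint (C i) (C j)) :
    ∃ e : V ≃ Fin n, (#{u | ¬ ∃ i, u ∈ C i ∧ (e u : ℕ) % r = i} : ℝ) ≤
      r + ∑ i, |(n : ℝ) / r - #(C i)| := by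
  -- As many vertices of each `C i` as fit are sent injectively into the `i`-th residue class, and
  -- this partial injection is extended to a bijection. As `∑ m i = n`, the exceptions number at
  -- most `∑ (m i - min (#(C i)) (m i))`.
  let m : Fin r → ℕ := fun i => #{x : Fin n | (x : ℕ) % r = i}
  have hS : ∀ i, ∃ S ⊆ C i, #S = min (#(C i)) (m i) := fun i =>
    exists_subset_card_eq (min_le_left _ _)
  choose S hSC hSc using hS
  have hg : ∀ i, Nonempty (S i ↪ {x : Fin n // (x : ℕ) % r = i}) := fun i =>
    Function.Embedding.nonempty_of_card_le (by
      rw [Fintype.card_coe, hSc, Fintype.card_subtype]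
      exact min_le_right _ _)
  let g := fun i => (hg i).some
  have hdisj : ∀ i j u, u ∈ S i → u ∈ S j → i = j := fun i j u hi hj => by
    by_contra h
    exact disjoint_left.1 (hC i j h) (hSC i hi) (hSC j hj)
  have hf : ∃ f : V → Fin n, ∀ i u (hu : u ∈ S i), f u = g i ⟨u, hu⟩ := by
    rcases isEmpty_or_nonempty V with hE | ⟨⟨v₀⟩⟩
    · exact ⟨fun u => hE.elim u, fun i u => hE.elim u⟩
    · have hn : 0 < n := hV ▸ Fintype.card_pos_iff.2 ⟨v₀⟩
      refine ⟨fun u => if h : ∃ i, u ∈ S i then g h.choose ⟨u, h.choose_spec⟩ else ⟨0, hn⟩,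
        fun i u hu => ?_⟩
      have h : ∃ i, u ∈ S i := ⟨i, hu⟩
      simp only [dif_pos h]
      have hi := hdisj _ _ _ h.choose_spec hu
      congr!
  obtain ⟨f, hf⟩ := hf
  have hfm : ∀ i, ∀ u ∈ S i, (f u : ℕ) % r = i := fun i u hu => by
    rw [hf i u hu]
    exact (g i ⟨u, hu⟩).2
  let U := (univ : Finset (Fin r)).biUnion S
  have hinj : Set.InjOn f U := by
    intro u hu w hw h
    obtain ⟨i, -, hi⟩ := mem_biUnion.1 (mem_coe.1 hu)
    obtain ⟨j, -, hj⟩ := mem_biUnion.1 (mem_coe.1 hw)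
    have hij : i = j := Fin.ext (by rw [← hfm i u hi, ← hfm j w hj, h])
    subst hij
    rw [hf i u hi, hf i w hj] at h
    exact congrArg Subtype.val ((g i).injective (Subtype.ext h))
  obtain ⟨e, he⟩ := exists_equiv_extend_of_card_eq (t := (univ : Finset (Fin n)))
    (by rw [hV, card_univ, Fintype.card_fin]) (subset_univ _) hinj
  let e' : V ≃ Fin n := e.trans (Equiv.subtypeUnivEquiv fun x => mem_univ x)
  refine ⟨e', ?_⟩
  have hsub : ({u | ¬ ∃ i, u ∈ C i ∧ (e' u : ℕ) % r = i} : Finset V) ⊆ Uᶜ := by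
    intro u hu
    rw [mem_compl]
    intro huU
    obtain ⟨i, -, hi⟩ := mem_biUnion.1 huU
    refine (mem_filter.1 hu).2 ⟨i, hSC i hi, ?_⟩
    have : e' u = f u := he u huU
    rw [this, hfm i u hi]
  have hUc : #U = ∑ i, min (#(C i)) (m i) := by
    rw [card_biUnion fun i _ j _ hij => (hC i j hij).mono (hSC i) (hSC j)]
    exact sum_congr rfl fun i _ => hSc i
  have hm : ∑ i, m i = n := sum_card_filter_mod hr
  have hcard : (#Uᶜ : ℝ) = ∑ i, ((m i : ℝ) - min (#(C i) : ℝ) (m i)) := by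
    rw [card_compl, Nat.cast_sub (card_le_univ _), hV, hUc, sum_sub_distrib, ← hm]
    push_cast
    rfl
  calc _ ≤ (#Uᶜ : ℝ) := by exact_mod_cast card_le_card hsub
    _ = _ := hcard
    _ ≤ ∑ i : Fin r, (1 + |(n : ℝ) / r - #(C i)|) := by
        refine sum_le_sum fun i _ => ?_
        have h1 : (m i : ℝ) ≤ n / r + 1 := by
          have h : m i ≤ n / r + 1 := card_filter_mod_le i
          have h' : ((m i : ℕ) : ℝ) ≤ ((n / r : ℕ) : ℝ) + 1 := by exact_mod_cast h
          exact h'.trans (by gcongr; exact Nat.cast_div_le)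
        rcases min_cases (#(C i) : ℝ) (m i) with ⟨h, -⟩ | ⟨h, -⟩
        · rw [h]
          linarith [le_abs_self ((n : ℝ) / r - #(C i))]
        · rw [h]
          linarith [abs_nonneg ((n : ℝ) / r - #(C i))]
    _ = _ := by simp [sum_add_distrib]

variable (G : SimpleGraph V)

/-- The ordered pairs lying in a common set. -/
noncomputable def samePairs {r : ℕ} (C : Fin r → Finset V) : Finset (V × V) :=
  univ.biUnion fun i => C i ×ˢ C i

/-- The ordered pairs lying in two different sets of the disjoint family `C`. -/
noncomputable def crossPairs {r : ℕ} (C : Fin r → Finset V) : Finset (V × V) :=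
  (univ.biUnion C ×ˢ univ.biUnion C) \ samePairs C

/-- A pair on which the two graphs disagree has an exceptional endpoint, or is an edge of `G` inside
some `C i`, or is a non-edge of `G` between two of the sets. Counting ordered pairs only
overestimates. -/
theorem ncard_symmDiff_comap_turanGraph_le {n r : ℕ} (C : Fin r → Finset V)
    (hC : ∀ i j, i ≠ j → Disjoint (C i) (C j)) (e : V ≃ Fin n) :
    (symmDiff G.edgeSet ((SimpleGraph.turanGraph n r).comap e).edgeSet).ncard ≤
      2 * n * #{u | ¬ ∃ i, u ∈ C i ∧ (e u : ℕ) % r = i} + #(samePairs C ∩ adjPairs G) +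
        #(crossPairs C \ adjPairs G) := by
  have hV : Fintype.card V = n := by rw [Fintype.card_congr e, Fintype.card_fin]
  set B : Finset V := {u | ¬ ∃ i, u ∈ C i ∧ (e u : ℕ) % r = i} with hB
  set X := crossPairs C with hX
  set T := (SimpleGraph.turanGraph n r).comap e with hT
  have hTadj : ∀ u w, T.Adj u w ↔ (e u : ℕ) % r ≠ (e w : ℕ) % r := fun u w => Iff.rfl
  set P : Finset (V × V) := (((B ×ˢ univ) ∪ (univ ×ˢ B)) ∪
    (samePairs C ∩ adjPairs G)) ∪ (X \ adjPairs G) with hP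
  have hPmem : ∀ u w, ¬ (G.Adj u w ↔ T.Adj u w) → (u, w) ∈ P := by
    intro u w h
    simp only [hP, mem_union, mem_product, mem_univ, and_true, true_and]
    by_cases hu : u ∈ B
    · exact Or.inl (Or.inl (Or.inl hu))
    by_cases hw : w ∈ B
    · exact Or.inl (Or.inl (Or.inr hw))
    simp only [hB, mem_filter, mem_univ, true_and, not_not] at hu hw
    obtain ⟨i, hui, hei⟩ := hu
    obtain ⟨j, hwj, hej⟩ := hw
    rw [hTadj, hei, hej] at h
    by_cases hij : i = j
    · subst hij
      refine Or.inl (Or.inr (mem_inter.2 ⟨mem_biUnion.2 ⟨i, mem_univ _, mem_product.2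
        ⟨hui, hwj⟩⟩, mem_filter.2 ⟨mem_univ _, ?_⟩⟩))
      simpa using h
    · have hij' : (i : ℕ) ≠ j := fun h => hij (Fin.ext h)
      have hnadj : ¬ G.Adj u w := by simpa [hij'] using h
      refine Or.inr (mem_sdiff.2 ⟨mem_sdiff.2 ⟨mem_product.2 ⟨mem_biUnion.2 ⟨i, mem_univ _, hui⟩,
        mem_biUnion.2 ⟨j, mem_univ _, hwj⟩⟩, fun hs => ?_⟩,
        fun hA => hnadj (mem_filter.1 hA).2⟩)
      obtain ⟨l, -, hl⟩ := mem_biUnion.1 hs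
      have hl' := mem_product.1 hl
      have h1 : l = i := by
        by_contra hne
        exact disjoint_left.1 (hC l i hne) hl'.1 hui
      have h2 : l = j := by
        by_contra hne
        exact disjoint_left.1 (hC l j hne) hl'.2 hwj
      exact hij (h1.symm.trans h2)
  have hncard : (symmDiff G.edgeSet T.edgeSet).ncard ≤ #P := by
    have hsub : symmDiff G.edgeSet T.edgeSet ⊆
        ((P.image fun p => s(p.1, p.2) : Finset (Sym2 V)) : Set (Sym2 V)) := by
      intro z
      induction z using Sym2.ind with
      | _ u w =>
        intro hz
        rw [Set.mem_symmDiff, SimpleGraph.mem_edgeSet, SimpleGraph.mem_edgeSet] at hz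
        exact mem_coe.2 (mem_image.2 ⟨(u, w), hPmem u w (by tauto), rfl⟩)
    calc _ ≤ _ := Set.ncard_le_ncard hsub (finite_toSet _)
      _ = _ := Set.ncard_coe_finset _
      _ ≤ #P := card_image_le
  refine hncard.trans ?_
  calc #P ≤ #((B ×ˢ (univ : Finset V)) ∪ ((univ : Finset V) ×ˢ B)) +
        #(samePairs C ∩ adjPairs G) + #(X \ adjPairs G) :=
        (card_union_le _ _).trans (Nat.add_le_add_right (card_union_le _ _) _)
    _ ≤ (#B * n + n * #B) + #(samePairs C ∩ adjPairs G) + #(X \ adjPairs G) := by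
        gcongr
        refine (card_union_le _ _).trans_eq ?_
        rw [card_product, card_product, card_univ, hV]
    _ = _ := by ring

/-- A graph whose number of edges is large compared with the edges inside disjoint sets is
close to the Turán graph. -/
theorem differsInFewerThan_turanGraph {n r : ℕ} (hr : 0 < r) (hV : Fintype.card V = n)
    (C : Fin r → Finset V) (hC : ∀ i j, i ≠ j → Disjoint (C i) (C j)) {a κ x : ℝ}
    (hedges : (1 - 1 / (r : ℝ) - a) * (n : ℝ) ^ 2 ≤ #(adjPairs G))
    (hκ : a * (n : ℝ) ^ 2 + #(samePairs C ∩ adjPairs G) +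
      3 * #((univ : Finset (Fin r)).biUnion C)ᶜ * n ≤ κ * (n : ℝ) ^ 2)
    (ha : 0 ≤ a)
    (hx : 2 * (r * n + √(r * κ) * (n : ℝ) ^ 2 + κ * (n : ℝ) ^ 2) < x) :
    DiffersInFewerThan G (SimpleGraph.turanGraph n r) x := by
  have hr0 : (0 : ℝ) < r := by exact_mod_cast hr
  have hr1 : 1 / (r : ℝ) ≤ 1 := by
    rw [div_le_one hr0]
    exact_mod_cast hr
  have hn0 : (0 : ℝ) ≤ n := by positivity
  set U := (univ : Finset (Fin r)).biUnion C with hU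
  set o := (#Uᶜ : ℝ) with ho
  set I := (#(samePairs C ∩ adjPairs G) : ℝ) with hI
  have ho0 : 0 ≤ o := by positivity
  have hI0 : 0 ≤ I := by positivity
  have hUo : (#U : ℝ) = n - o := by
    have := card_add_card_compl U
    rw [hV] at this
    rw [ho, ← this]
    push_cast
    ring
  have hon : o ≤ n := by
    have : (0 : ℝ) ≤ #U := by positivity
    linarith
  have hsumC : ∑ i, (#(C i) : ℝ) = n - o := by
    rw [← hUo, hU, card_biUnion fun i _ j _ hij => hC i j hij]
    push_cast
    rfl
  have hsame : (#(samePairs C) : ℝ) = ∑ i, (#(C i) : ℝ) ^ 2 := by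
    rw [samePairs, card_biUnion fun i _ j _ hij => disjoint_product.2 (Or.inl (hC i j hij))]
    push_cast [card_product]
    exact sum_congr rfl fun i _ => (pow_two _).symm
  have hsameU : samePairs C ⊆ U ×ˢ U := by
    intro p hp
    obtain ⟨i, -, hi⟩ := mem_biUnion.1 hp
    rw [mem_product] at hi ⊢
    exact ⟨mem_biUnion.2 ⟨i, mem_univ _, hi.1⟩, mem_biUnion.2 ⟨i, mem_univ _, hi.2⟩⟩
  set X := crossPairs C with hX
  have hXc : (#X : ℝ) = (n - o) ^ 2 - ∑ i, (#(C i) : ℝ) ^ 2 := by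
    rw [hX, crossPairs, ← hU, card_sdiff_of_subset hsameU, Nat.cast_sub (card_le_card hsameU), hsame, card_product]
    push_cast
    rw [hUo]
    ring
  have hXsplit : (#(X ∩ adjPairs G) : ℝ) + #(X \ adjPairs G) = #X := by
    exact_mod_cast card_inter_add_card_sdiff X (adjPairs G)
  have hE : (#(adjPairs G) : ℝ) ≤ 2 * o * n + I + #(X ∩ adjPairs G) := by
    have hsub : adjPairs G ⊆ ((Uᶜ ×ˢ univ) ∪ (univ ×ˢ Uᶜ)) ∪
        (samePairs C ∩ adjPairs G) ∪ (X ∩ adjPairs G) := by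
      intro p hp
      simp only [mem_union, mem_inter, mem_product, mem_compl, mem_univ, and_true, true_and, hp,
        hX, crossPairs, ← hU, mem_sdiff]
      tauto
    have h := (card_le_card hsub).trans ((card_union_le _ _).trans
      (add_le_add_left ((card_union_le _ _).trans
        (add_le_add_left (card_union_le _ _) _)) _))
    rw [card_product, card_product, card_univ, hV] at h
    have h' : (#(adjPairs G) : ℝ) ≤ o * n + n * o + I + #(X ∩ adjPairs G) := by
      rw [ho, hI]
      exact_mod_cast h
    linarith
  have hXM : (0 : ℝ) ≤ #(X \ adjPairs G) := by positivity
  set Q := ∑ i, (#(C i) : ℝ) ^ 2 with hQ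
  have hQlow : (n : ℝ) ^ 2 * (1 / r) - 2 * o * n ≤ Q := by
    have h := sq_sum_le_card_mul_sum_sq (s := (univ : Finset (Fin r))) (f := fun i => (#(C i) : ℝ))
    rw [hsumC, card_univ, Fintype.card_fin] at h
    have h2 : (n - o) ^ 2 * (1 / r) ≤ Q := by
      rw [mul_one_div, div_le_iff₀ hr0]
      linarith
    have h3 : 2 * o * n * (1 / r) ≤ 2 * o * n * 1 := by gcongr
    have h4 : 0 ≤ o ^ 2 * (1 / r) := by positivity
    nlinarith
  -- Convexity (`hQlow`) limits the number of cross pairs, while `hE` forces almost that many to be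
  -- edges. The losses `2 o n` and `o² ≤ o n` add up to the `3 o n` in `hκ`.
  have hM : (#(X \ adjPairs G) : ℝ) ≤ κ * n ^ 2 := by nlinarith [mul_nonneg ho0 hn0]
  have hQup : Q ≤ n ^ 2 * (1 / r) + a * n ^ 2 + o * n + I := by nlinarith
  -- Conversely, having many edges bounds the sum of squared class sizes from above, so the sizes
  -- have small variance; Cauchy–Schwarz turns this into few exceptions.
  have hdev : ∑ i, ((n : ℝ) / r - #(C i)) ^ 2 ≤ κ * n ^ 2 := by
    have h1 : ∑ i, ((n : ℝ) / r - #(C i)) ^ 2 =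
        Q - n ^ 2 * (1 / r) + 2 * o * n * (1 / r) := by
      have : ∀ i, ((n : ℝ) / r - #(C i)) ^ 2 =
          (n / r) ^ 2 - 2 * (n / r) * #(C i) + (#(C i) : ℝ) ^ 2 := fun i => by ring
      simp_rw [this]
      rw [sum_add_distrib, sum_sub_distrib, ← mul_sum, hsumC]
      simp only [sum_const, card_univ, Fintype.card_fin, nsmul_eq_mul]
      field_simp
      ring
    have h3 : 2 * o * n * (1 / r) ≤ 2 * o * n * 1 := by gcongr
    rw [h1]
    linarith
  obtain ⟨e, he⟩ := exists_equiv_card_exceptions_le hr hV C hC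
  set B : Finset V := {u | ¬ ∃ i, u ∈ C i ∧ (e u : ℕ) % r = i} with hB
  have hBc : (#B : ℝ) ≤ r + √(r * κ) * n := by
    refine he.trans (by
      gcongr
      have hs : √(r * κ) * n = √(r * κ * n ^ 2) := by
        rw [Real.sqrt_mul' _ (sq_nonneg _), Real.sqrt_sq hn0]
      rw [hs]
      refine Real.le_sqrt_of_sq_le ?_
      have h := sq_sum_le_card_mul_sum_sq (s := (univ : Finset (Fin r)))
        (f := fun i => |(n : ℝ) / r - #(C i)|)
      simp only [sq_abs, card_univ, Fintype.card_fin] at h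
      calc _ ≤ _ := h
        _ ≤ r * (κ * n ^ 2) := by gcongr
        _ = r * κ * n ^ 2 := by ring)
  refine ⟨(SimpleGraph.turanGraph n r).comap e, ⟨SimpleGraph.Iso.comap e _⟩, ?_⟩
  have hcard : ((symmDiff G.edgeSet ((SimpleGraph.turanGraph n r).comap e).edgeSet).ncard : ℝ) ≤
      2 * n * #B + I + #(X \ adjPairs G) := by
    rw [hI]
    exact_mod_cast ncard_symmDiff_comap_turanGraph_le G C hC e
  have hIκ : I ≤ κ * n ^ 2 := by
    linarith [mul_nonneg ho0 hn0, mul_nonneg ha (sq_nonneg (n : ℝ))]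
  refine lt_of_le_of_lt ?_ hx
  calc _ ≤ _ := hcard
    _ ≤ 2 * n * (r + √(r * κ) * n) + κ * n ^ 2 + κ * n ^ 2 := by gcongr
    _ = _ := by ring

end TuranDistance

/-! ### Choice of constants and the dichotomy -/

section MainResult

open Classical Finset

variable {V : Type*} [Fintype V] (G : SimpleGraph V)

/-- Take `2 ≤ D d ≤ 3` and `L = log n`. The bottom level has `D ^ r * s ≤ 3 ^ r d L` rows, whose
cost fits in `n` because `4 * 3 ^ r * d ≤ 1`. The last extension costs at most `exp (5 d ^ r L)`,
and `5 d ^ r ≤ √(d ^ (r + 1))` since `25 d ^ (r - 1) ≤ 1`; this is the loss `n ^ √c`. -/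
theorem completePartiteOneLarge_isContained_of_many_cliques {r : ℕ} (hr : 2 ≤ r) {d : ℝ}
    (hd : 0 < d) (hd1 : 4 * 3 ^ r * d ≤ 1)
    (hn : Real.exp (1 / d ^ (r + 1)) < Fintype.card V)
    (hG : ((r : ℝ) + 1) * d * (Fintype.card V : ℝ) ^ (r + 1) ≤
      #{x : Fin (r + 1) → V | IsCliqueTuple G x}) :
    completePartiteOneLarge (r + 1) ⌊d ^ (r + 1) * Real.log (Fintype.card V)⌋₊
      ⌈(Fintype.card V : ℝ) ^ (1 - Real.sqrt (d ^ (r + 1)))⌉₊ ⊑ G := by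
  set n := (Fintype.card V : ℝ) with hn'
  have hn0 : 0 < n := (Real.exp_pos _).trans hn
  set L := Real.log n with hL
  have hLc : 1 / d ^ (r + 1) < L := (Real.lt_log_iff_exp_lt hn0).2 hn
  have hnL : n = Real.exp L := (Real.exp_log hn0).symm
  have hdp : 0 < d ^ (r + 1) := by positivity
  have hcL : 1 < d ^ (r + 1) * L := by
    rw [div_lt_iff₀ hdp] at hLc
    linarith
  have hL0 : 0 < L := lt_trans (by positivity) hLc
  have h3r : (1 : ℝ) ≤ 3 ^ r := one_le_pow₀ (by norm_num)
  have h9r : (9 : ℝ) ≤ 3 ^ r := by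
    calc (9 : ℝ) = 3 ^ 2 := by norm_num
      _ ≤ 3 ^ r := pow_le_pow_right₀ (by norm_num) hr
  have hd36 : 36 * d ≤ 1 := by nlinarith
  have hdle : d ≤ 1 := by linarith
  set s := ⌊d ^ (r + 1) * L⌋₊ with hs
  have hs0 : 0 < s := Nat.floor_pos.2 hcL.le
  have hsle : (s : ℝ) ≤ d ^ (r + 1) * L := Nat.floor_le (by positivity)
  obtain ⟨D, hD2, hD3⟩ : ∃ D : ℕ, 2 ≤ D * d ∧ D * d ≤ 3 := by
    refine ⟨⌈2 / d⌉₊, ?_, ?_⟩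
    · exact (div_le_iff₀ hd).1 (Nat.le_ceil _)
    · have h := (Nat.ceil_lt_add_one (a := 2 / d) (by positivity)).le
      calc (⌈2 / d⌉₊ : ℝ) * d ≤ (2 / d + 1) * d := by gcongr
        _ = 2 + d := by field_simp
        _ ≤ 3 := by linarith
  have hDs : (D : ℝ) * s ≤ 3 * (d ^ r * L) := by
    calc (D : ℝ) * s ≤ D * (d ^ (r + 1) * L) := by gcongr
      _ = (D * d) * (d ^ r * L) := by ring
      _ ≤ _ := by gcongr
  have hDrs : (D : ℝ) ^ r * s ≤ 3 ^ r * (d * L) := by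
    calc (D : ℝ) ^ r * s ≤ D ^ r * (d ^ (r + 1) * L) := by gcongr
      _ = (D * d) ^ r * (d * L) := by ring
      _ ≤ _ := by gcongr
  have h2d : 2 / d ≤ Real.exp (2 * (d ^ r * L)) := by
    have h1 : 1 / d ≤ d ^ r * L := by
      rw [div_le_iff₀ hd]
      calc (1 : ℝ) ≤ d ^ (r + 1) * L := hcL.le
        _ = _ := by ring
    calc 2 / d = 2 * (1 / d) := by ring
      _ ≤ 2 * (d ^ r * L) := by gcongr
      _ ≤ 2 * (d ^ r * L) + 1 := by linarith
      _ ≤ _ := Real.add_one_le_exp _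
  have h2exp : (2 : ℝ) ≤ Real.exp 1 := by linarith [Real.add_one_le_exp (1 : ℝ)]
  have hdr : d ^ r ≤ d := by
    simpa using pow_le_pow_of_le_one hd.le hdle (by omega : 1 ≤ r)
  obtain ⟨k, rfl⟩ : ∃ k, r = k + 1 := ⟨r - 1, by omega⟩
  refine completePartiteOneLarge_isContained G hd hdle hD2 hs0 ?_ ?_
    {x : Fin (k + 2) → V | IsCliqueTuple G x} (fun x hx => (mem_filter.1 hx).2) ?_
  · rw [← hn', hnL]
    have h4 : (4 : ℝ) ^ (D ^ (k + 1) * s) ≤ Real.exp (2 * (3 ^ (k + 1) * (d * L))) := by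
      calc (4 : ℝ) ^ (D ^ (k + 1) * s) ≤ (Real.exp 2) ^ (D ^ (k + 1) * s) := by
            gcongr
            calc (4 : ℝ) = 2 * 2 := by norm_num
              _ ≤ Real.exp 1 * Real.exp 1 := by gcongr
              _ = Real.exp 2 := by rw [← Real.exp_add]; norm_num
        _ = Real.exp (2 * ((D : ℝ) ^ (k + 1) * s)) := by
            rw [← Real.exp_nat_mul]
            push_cast
            ring_nf
        _ ≤ _ := by gcongr
    calc _ ≤ Real.exp (2 * (3 ^ (k + 1) * (d * L))) * Real.exp (2 * (d ^ (k + 1) * L)) := by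
          gcongr
      _ = Real.exp (2 * (3 ^ (k + 1) * (d * L)) + 2 * (d ^ (k + 1) * L)) := by
          rw [Real.exp_add]
      _ ≤ Real.exp L := by
          rw [Real.exp_le_exp]
          have h1 : d ^ (k + 1) * L ≤ 3 ^ (k + 1) * (d * L) := by
            calc d ^ (k + 1) * L ≤ 1 * (d * L) := by rw [one_mul]; gcongr
              _ ≤ _ := by gcongr
          have h2 := mul_le_mul_of_nonneg_right hd1 hL0.le
          linarith
  · have ht := Nat.ceil_lt_add_one (a := n ^ (1 - √(d ^ (k + 1 + 1)))) (by positivity)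
    have hsq : 5 * d ^ (k + 1) ≤ √(d ^ (k + 1 + 1)) := by
      refine Real.le_sqrt_of_sq_le ?_
      have hk : d ^ k ≤ d := by simpa using pow_le_pow_of_le_one hd.le hdle (by omega : 1 ≤ k)
      calc (5 * d ^ (k + 1)) ^ 2 = 25 * d ^ k * d ^ (k + 1 + 1) := by ring
        _ ≤ 25 * d * d ^ (k + 1 + 1) := by gcongr
        _ ≤ 1 * d ^ (k + 1 + 1) := by gcongr; linarith
        _ = _ := one_mul _
    have hpow : (2 : ℝ) ^ (D * s) * (2 / d) ≤ n ^ √(d ^ (k + 1 + 1)) := by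
      calc (2 : ℝ) ^ (D * s) * (2 / d) ≤
            Real.exp (3 * (d ^ (k + 1) * L)) * Real.exp (2 * (d ^ (k + 1) * L)) := by
            gcongr
            calc (2 : ℝ) ^ (D * s) ≤ (Real.exp 1) ^ (D * s) := by gcongr
              _ = Real.exp (D * s) := by
                rw [← Real.exp_nat_mul]
                push_cast
                ring_nf
              _ ≤ _ := by gcongr
        _ = Real.exp (L * (5 * d ^ (k + 1))) := by
            rw [← Real.exp_add]
            ring_nf
        _ ≤ Real.exp (L * √(d ^ (k + 1 + 1))) := by gcongr
        _ = _ := by rw [Real.rpow_def_of_pos hn0]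
    have hmain : n ^ (1 - √(d ^ (k + 1 + 1))) * 2 ^ (D * s) ≤ d / 2 * n := by
      have h1 : n ^ (1 - √(d ^ (k + 1 + 1))) * ((2 : ℝ) ^ (D * s) * (2 / d)) ≤ n := by
        calc _ ≤ n ^ (1 - √(d ^ (k + 1 + 1))) * n ^ √(d ^ (k + 1 + 1)) := by gcongr
          _ = n := by rw [← Real.rpow_add hn0]; simp
      have h2 := mul_le_mul_of_nonneg_left h1 (by positivity : 0 ≤ d / 2)
      calc _ = d / 2 * (n ^ (1 - √(d ^ (k + 1 + 1))) * ((2 : ℝ) ^ (D * s) * (2 / d))) := by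
            field_simp
        _ ≤ _ := h2
    have h2pos : (0 : ℝ) < 2 ^ (D * s) := by positivity
    calc _ < (n ^ (1 - √(d ^ (k + 1 + 1))) + 1) * 2 ^ (D * s) := by gcongr
      _ = n ^ (1 - √(d ^ (k + 1 + 1))) * 2 ^ (D * s) + 2 ^ (D * s) := by ring
      _ ≤ _ := by gcongr
  · push_cast at hG
    rw [add_assoc, one_add_one_eq_two] at hG
    exact hG

theorem cliquePart_disjoint {k : ℕ} (x : Fin k → V) (i j : Fin k) (hij : i ≠ j) :
    Disjoint (cliquePart G x i) (cliquePart G x j) :=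
  disjoint_left.2 fun _ hi hj => (mem_filter.1 hi).2.1 ((mem_filter.1 hj).2.2 i hij)

theorem compl_biUnion_cliquePart {k : ℕ} (x : Fin k → V) :
    (univ.biUnion (cliquePart G x))ᶜ = cliqueOutside G x := by
  ext u
  simp [cliqueOutside]

theorem insideWeight_const {k : ℕ} (x : Fin k → V) (b : ℝ) :
    insideWeight G (fun _ => b) x =
      #(samePairs (cliquePart G x) ∩ adjPairs G) * b ^ 2 := by
  rw [samePairs, biUnion_inter, card_biUnion, insideWeight]
  · push_cast
    rw [sum_mul]
    refine sum_congr rfl fun i _ => ?_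
    rw [← sum_product', ← sum_filter, sum_const, nsmul_eq_mul, pow_two]
    congr 3
    ext p
    simp [adjPairs]
  · intro i _ j _ hij
    exact (disjoint_product.2 (Or.inl (cliquePart_disjoint G x i j hij))).mono
      inter_subset_left inter_subset_left

theorem turan_distance_bound {r η e κ n : ℝ} (hr : 2 ≤ r) (hη0 : 0 < η) (he0 : 0 < e)
    (hη3 : η * r ^ 3 * 2 ^ 20 ≤ 1) (he3 : e * r ^ 3 * 2 ^ 9 ≤ 1) (hη1 : η ≤ 1) (he1 : e ≤ 1)
    (hn0 : 0 < n) (hn : 1 ≤ n * η ^ 2)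
    (hκ : κ ≤ 6 * r ^ 2 * e ^ 4 + 4 * r ^ 2 * η ^ 3) :
    2 * (r * n + √(r * κ) * n ^ 2 + κ * n ^ 2) < (e + η) * n ^ 2 := by
  have hr1 : 1 ≤ r := by linarith
  have hr0 : 0 < r := by linarith
  have hr23 : r ^ 2 ≤ r ^ 3 := pow_le_pow_right₀ hr1 (by norm_num)
  have hηr2 : η * r ^ 2 * 2 ^ 20 ≤ 1 := le_trans (by gcongr) hη3
  have her2 : e * r ^ 2 * 2 ^ 9 ≤ 1 := le_trans (by gcongr) he3
  have hκ2 : κ ≤ e / 8 + η / 8 := by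
    have t1 : 6 * r ^ 2 * e ^ 4 ≤ e / 8 := by
      calc 6 * r ^ 2 * e ^ 4 = e * (6 * (e * r ^ 2) * e ^ 2) := by ring
        _ ≤ e * (6 * (1 / 2 ^ 9) * 1 ^ 2) := by
            gcongr
            · rw [le_div_iff₀ (by positivity)]; exact her2
        _ ≤ e / 8 := by linarith
    have t2 : 4 * r ^ 2 * η ^ 3 ≤ η / 8 := by
      calc 4 * r ^ 2 * η ^ 3 = η * (4 * (η * r ^ 2) * η) := by ring
        _ ≤ η * (4 * (1 / 2 ^ 20) * 1) := by
            gcongr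
            · rw [le_div_iff₀ (by positivity)]; exact hηr2
        _ ≤ η / 8 := by linarith
    linarith
  -- The square root leaves `e²` and `η ^ (3/2)`; the surplus powers over `e` and `η` absorb those
  -- of `r`.
  have hsqrt : √(r * κ) ≤ e / 4 + η / 8 := by
    rw [Real.sqrt_le_left (by positivity)]
    have t1 : 6 * r ^ 3 * e ^ 4 ≤ e ^ 2 / 16 := by
      calc 6 * r ^ 3 * e ^ 4 = e ^ 2 * (6 * (e * r ^ 3) * e) := by ring
        _ ≤ e ^ 2 * (6 * (1 / 2 ^ 9) * 1) := by
            gcongr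
            · rw [le_div_iff₀ (by positivity)]; exact he3
        _ ≤ e ^ 2 / 16 := by nlinarith
    have t2 : 4 * r ^ 3 * η ^ 3 ≤ η ^ 2 / 64 := by
      calc 4 * r ^ 3 * η ^ 3 = η ^ 2 * (4 * (η * r ^ 3)) := by ring
        _ ≤ η ^ 2 * (4 * (1 / 2 ^ 20)) := by
            gcongr
            rw [le_div_iff₀ (by positivity)]; exact hη3
        _ ≤ η ^ 2 / 64 := by nlinarith
    calc r * κ ≤ r * (6 * r ^ 2 * e ^ 4 + 4 * r ^ 2 * η ^ 3) := by gcongr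
      _ = 6 * r ^ 3 * e ^ 4 + 4 * r ^ 3 * η ^ 3 := by ring
      _ ≤ e ^ 2 / 16 + η ^ 2 / 64 := by linarith
      _ ≤ (e / 4 + η / 8) ^ 2 := by nlinarith [mul_pos he0 hη0]
  have hrn : r ≤ η / 8 * n := by
    have t1 : 8 * r * η ≤ 1 := by
      have : r * η ≤ r ^ 3 * η := by
        gcongr
        exact le_self_pow₀ hr1 (by norm_num)
      nlinarith
    have t2 : 8 * r * η ≤ n * η * η := by nlinarith
    have := le_of_mul_le_mul_right t2 hη0
    linarith
  calc 2 * (r * n + √(r * κ) * n ^ 2 + κ * n ^ 2) ≤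
        2 * (η / 8 * n * n + (e / 4 + η / 8) * n ^ 2 + (e / 8 + η / 8) * n ^ 2) := by gcongr
    _ = 3 / 4 * ((e + η) * n ^ 2) := by ring
    _ < (e + η) * n ^ 2 := by
        have : 0 < (e + η) * n ^ 2 := by positivity
        linarith

theorem differsInFewerThan_of_few_cliques {r : ℕ} (hr : 2 ≤ r) {η e : ℝ} (hη0 : 0 < η)
    (hη : η * (r : ℝ) ^ (r + 21) ≤ 1) (he0 : 0 < e) (he : e * (2 ^ 9 * (r : ℝ) ^ 6) ≤ 1)
    (hn : 1 ≤ Fintype.card V * η ^ 2)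
    (hμ : (1 - 1 / (r : ℝ) - e ^ 4) * Fintype.card V ≤ graphSpectralRadius G)
    (hG : (#{x : Fin (r + 1) → V | IsCliqueTuple G x} : ℝ) ≤
      ((r : ℝ) + 1) * η ^ 8 * (Fintype.card V : ℝ) ^ (r + 1)) :
    DiffersInFewerThan G (SimpleGraph.turanGraph (Fintype.card V) r)
      ((e + η) * (Fintype.card V : ℝ) ^ 2) := by
  have hr2 : (2 : ℝ) ≤ r := by exact_mod_cast hr
  have hr1 : (1 : ℝ) ≤ r := by linarith
  have hr0 : (0 : ℝ) < r := by linarith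
  set n := (Fintype.card V : ℝ) with hn'
  have hn0 : 0 < n := by
    by_contra h
    have : n * η ^ 2 ≤ 0 := mul_nonpos_of_nonpos_of_nonneg (not_lt.1 h) (by positivity)
    linarith
  have : Nonempty V := Fintype.card_pos_iff.1 (by
    rw [hn'] at hn0
    exact_mod_cast hn0)
  have hη23 : η * (r : ℝ) ^ 23 ≤ 1 := by
    refine le_trans ?_ hη
    gcongr
    omega
  have h20 : (2 : ℝ) ^ 20 ≤ (r : ℝ) ^ 20 := by gcongr
  have hη3 : η * r ^ 3 * 2 ^ 20 ≤ 1 := by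
    calc η * r ^ 3 * 2 ^ 20 ≤ η * r ^ 3 * r ^ 20 := by gcongr
      _ = η * r ^ 23 := by ring
      _ ≤ 1 := hη23
  have hr3 : (8 : ℝ) ≤ r ^ 3 := by
    calc (8 : ℝ) = 2 ^ 3 := by norm_num
      _ ≤ r ^ 3 := by gcongr
  have hr23 : (r : ℝ) ^ 2 ≤ r ^ 3 := pow_le_pow_right₀ hr1 (by norm_num)
  have hr26 : (r : ℝ) ^ 3 ≤ r ^ 6 := pow_le_pow_right₀ hr1 (by norm_num)
  have hη1 : η ≤ 1 / 2 := by nlinarith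
  have he3 : e * r ^ 3 * 2 ^ 9 ≤ 1 := by
    calc e * r ^ 3 * 2 ^ 9 ≤ e * r ^ 6 * 2 ^ 9 := by gcongr
      _ = e * (2 ^ 9 * r ^ 6) := by ring
      _ ≤ 1 := he
  have he1 : e ≤ 1 / 2 := by nlinarith
  have hηr2 : η * r ^ 2 * 2 ^ 20 ≤ 1 := le_trans (by gcongr) hη3
  have her2 : e * r ^ 2 * 2 ^ 9 ≤ 1 := le_trans (by gcongr) he3
  -- All constants are at most `r ^ (5r + 5)`, which five of the eight factors `η` absorb by `hη`.
  have hcount : (2 * (r : ℝ)) ^ r * (5 ^ (r + 1) * (((r : ℝ) + 1) * η ^ 8)) ≤ η ^ 3 := by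
    have e1 : (2 * (r : ℝ)) ≤ r ^ 2 := by nlinarith
    have e2 : (5 : ℝ) ≤ r ^ 3 := by linarith
    have e3 : (r : ℝ) + 1 ≤ r ^ 2 := by nlinarith
    calc (2 * (r : ℝ)) ^ r * (5 ^ (r + 1) * (((r : ℝ) + 1) * η ^ 8)) ≤
          (r ^ 2) ^ r * ((r ^ 3) ^ (r + 1) * (r ^ 2 * η ^ 8)) := by gcongr
      _ = r ^ (5 * r + 5) * η ^ 5 * η ^ 3 := by ring
      _ ≤ r ^ (5 * (r + 21)) * η ^ 5 * η ^ 3 := by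
          gcongr
          omega
      _ = (η * r ^ (r + 21)) ^ 5 * η ^ 3 := by ring
      _ ≤ 1 ^ 5 * η ^ 3 := by gcongr
      _ = η ^ 3 := by ring
  have he4 : e ^ 4 ≤ e / 8 := by
    calc e ^ 4 = e * e ^ 3 := by ring
      _ ≤ e * (1 / 2) ^ 3 := by gcongr
      _ = e / 8 := by ring
  have hηcube : η ^ 3 ≤ η / 4 := by
    calc η ^ 3 = η * η ^ 2 := by ring
      _ ≤ η * (1 / 2) ^ 2 := by gcongr
      _ = η / 4 := by ring
  have he512 : e ≤ 1 / 512 := by nlinarith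
  have hedges := card_adjPairs_ge_of_spectralRadius G hr (ε := e ^ 4)
    (β := ((r : ℝ) + 1) * η ^ 8) (δ := η ^ 3) (by positivity) (by linarith) hμ hG hcount
    (by positivity)
  set a := 2 * e ^ 4 + η ^ 3 with ha
  have ha0 : 0 ≤ a := by positivity
  have har : a ≤ 1 / (2 * (r : ℝ) ^ 2) := by
    rw [le_div_iff₀ (by positivity)]
    have h1 : a ≤ e / 4 + η / 4 := by rw [ha]; linarith
    calc a * (2 * r ^ 2) ≤ (e / 4 + η / 4) * (2 * r ^ 2) := by gcongr
      _ ≤ 1 := by linarith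
  obtain ⟨k, rfl⟩ : ∃ k, r = k + 1 := ⟨r - 1, by omega⟩
  have hy : ∀ v : V, 0 ≤ (fun _ : V => 1 / n) v := fun _ => by positivity
  have h1 : ∑ v : V, (fun _ : V => 1 / n) v = 1 := by
    simp only [sum_const, card_univ, nsmul_eq_mul]
    rw [← hn', mul_one_div, div_self hn0.ne']
  obtain ⟨x, -, hx⟩ := exists_clique_outside_inside_le G hy h1 (k := k) (by omega) (a := a)
    (by push_cast at har; exact har) (by
      rw [cliqueWeight_two_const, one_div_pow, mul_one_div, le_div_iff₀ (by positivity)]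
      push_cast at hedges
      exact hedges)
  have hcw : cliqueWeight G (fun _ => 1 / n) (k + 2) ≤ (((k + 1 : ℕ) : ℝ) + 1) * η ^ 8 := by
    rw [cliqueWeight_const, one_div_pow, mul_one_div, div_le_iff₀ (by positivity)]
    exact hG
  rw [insideWeight_const, sum_const, nsmul_eq_mul] at hx
  set I := (#(samePairs (cliquePart G x) ∩ adjPairs G) : ℝ)
  set o := (#(cliqueOutside G x) : ℝ)
  have hkr : ((k : ℝ) + 1) = ((k + 1 : ℕ) : ℝ) := by push_cast; rfl
  have hkr' : (k : ℝ) = ((k + 1 : ℕ) : ℝ) - 1 := by push_cast; ring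
  have hlast : 4 * ((k : ℝ) + 1) * (2 * ((k : ℝ) + 1)) ^ k *
      cliqueWeight G (fun _ => 1 / n) (k + 2) ≤ η ^ 3 := by
    refine le_trans ?_ hcount
    rw [hkr]
    have h5 : (2 : ℝ) ≤ 5 ^ (k + 1 + 1) := by
      calc (2 : ℝ) ≤ 5 ^ 1 := by norm_num
        _ ≤ _ := pow_le_pow_right₀ (by norm_num) (by omega)
    calc _ ≤ 4 * ((k + 1 : ℕ) : ℝ) * (2 * ((k + 1 : ℕ) : ℝ)) ^ k *
          ((((k + 1 : ℕ) : ℝ) + 1) * η ^ 8) := by gcongr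
      _ = (2 * ((k + 1 : ℕ) : ℝ)) ^ (k + 1) * (2 * ((((k + 1 : ℕ) : ℝ) + 1) * η ^ 8)) := by ring
      _ ≤ _ := by gcongr
  rw [hkr, hkr'] at hx
  rw [hkr] at hlast
  set r : ℝ := ((k + 1 : ℕ) : ℝ) with hrdef
  -- The chosen clique contributes `3 r (r - 1) a + η ^ 3`; the edge deficit `a ≤ 3 r a` completes
  -- `3 r² a`.
  set κ := 3 * r ^ 2 * a + η ^ 3 with hκ
  have hκ' : a + I * (1 / n) ^ 2 + 3 * (o * (1 / n)) ≤ κ := by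
    have h3 : 1 * a ≤ 3 * r * a := by
      gcongr
      linarith
    rw [hκ]
    linarith
  refine differsInFewerThan_turanGraph G (κ := κ) (Nat.succ_pos k) rfl (cliquePart G x)
    (cliquePart_disjoint G x) hedges ?_ ha0 ?_
  · rw [compl_biUnion_cliquePart]
    have h := mul_le_mul_of_nonneg_right hκ' (by positivity : 0 ≤ n ^ 2)
    have h' : (a + I * (1 / n) ^ 2 + 3 * (o * (1 / n))) * n ^ 2 = a * n ^ 2 + I + 3 * o * n := by
      field_simp
    rwa [h'] at h
  · refine turan_distance_bound hr2 hη0 he0 hη3 he3 (by linarith) (by linarith) hn0 hn ?_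
    have : η ^ 3 ≤ r ^ 2 * η ^ 3 := le_mul_of_one_le_left (by positivity) (one_le_pow₀ hr1)
    rw [hκ, ha]
    linarith

end MainResult

theorem mainTheorem2 {V : Type*} [Fintype V] (G : SimpleGraph V) (r n : ℕ) (c ε : ℝ)
    (hr : 2 ≤ r)
    (hc₀ : 0 < c) (hc : c < (r : ℝ) ^ (-(8 * ((r : ℤ) + 21) * ((r : ℤ) + 1))))
    (hε₀ : 0 < ε) (hε : ε < (2 : ℝ) ^ (-36 : ℤ) * (r : ℝ) ^ (-24 : ℤ))
    (hn : Real.exp (1 / c) < (n : ℝ))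
    (hG : Fintype.card V = n)
    (hμ : (1 - 1 / (r : ℝ) - ε) * (n : ℝ) < graphSpectralRadius G) :
    (completePartiteOneLarge (r + 1) ⌊c * Real.log n⌋₊ ⌈(n : ℝ) ^ (1 - Real.sqrt c)⌉₊ ⊑ G) ∨
      DiffersInFewerThan G (SimpleGraph.turanGraph n r)
        ((ε ^ (1 / 4 : ℝ) + c ^ (1 / (8 * (r : ℝ) + 8))) * (n : ℝ) ^ 2) := by
  classical
  subst hG
  have hr2 : (2 : ℝ) ≤ r := by exact_mod_cast hr
  have hr1 : (1 : ℝ) ≤ r := by linarith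
  have hr0 : (0 : ℝ) < r := by linarith
  -- In terms of `η` and `e` the bounds on `c` and `ε` say that `η * r ^ (r + 21)` and `e * 2 ^ 9 *
  -- r ^ 6` are below 1.
  set η := c ^ (1 / (8 * (r : ℝ) + 8)) with hη
  set e := ε ^ (1 / 4 : ℝ) with he
  have hη0 : 0 < η := by positivity
  have he0 : 0 < e := by positivity
  have hηc : η ^ (8 * (r + 1)) = c := by
    rw [hη, ← Real.rpow_natCast, ← Real.rpow_mul hc₀.le]
    have : 1 / (8 * (r : ℝ) + 8) * ((8 * (r + 1) : ℕ) : ℝ) = 1 := by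
      push_cast
      field_simp
    rw [this, Real.rpow_one]
  have heε : e ^ 4 = ε := by
    rw [he, ← Real.rpow_natCast, ← Real.rpow_mul hε₀.le]
    norm_num
  have hηr : η * (r : ℝ) ^ (r + 21) ≤ 1 := by
    refine (pow_le_one_iff_of_nonneg (by positivity) (by omega : 8 * (r + 1) ≠ 0)).1 ?_
    rw [mul_pow, hηc, ← pow_mul]
    have hz : (r : ℝ) ^ (-(8 * ((r : ℤ) + 21) * ((r : ℤ) + 1))) =
        ((r : ℝ) ^ ((r + 21) * (8 * (r + 1))))⁻¹ := by
      rw [← zpow_natCast, ← zpow_neg]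
      congr 1
      push_cast
      ring
    rw [hz, lt_inv_comm₀ hc₀ (by positivity)] at hc
    calc c * (r : ℝ) ^ ((r + 21) * (8 * (r + 1))) ≤ c * c⁻¹ := by gcongr
      _ = 1 := mul_inv_cancel₀ hc₀.ne'
  have her : e * (2 ^ 9 * (r : ℝ) ^ 6) ≤ 1 := by
    refine (pow_le_one_iff_of_nonneg (by positivity) (by norm_num : 4 ≠ 0)).1 ?_
    rw [mul_pow, heε]
    calc ε * (2 ^ 9 * (r : ℝ) ^ 6) ^ 4 ≤
          (2 : ℝ) ^ (-36 : ℤ) * (r : ℝ) ^ (-24 : ℤ) * (2 ^ 9 * (r : ℝ) ^ 6) ^ 4 := by gcongr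
      _ = 1 := by
          rw [show (-36 : ℤ) = -((36 : ℕ) : ℤ) by norm_num,
            show (-24 : ℤ) = -((24 : ℕ) : ℤ) by norm_num, zpow_neg, zpow_neg, zpow_natCast,
            zpow_natCast]
          field_simp
  have hη1 : η ≤ 1 := by
    calc η = η * 1 := (mul_one _).symm
      _ ≤ η * (r : ℝ) ^ (r + 21) := by
          gcongr
          exact one_le_pow₀ hr1
      _ ≤ 1 := hηr
  have hd : (η ^ 8) ^ (r + 1) = c := by rw [← pow_mul, hηc]
  -- The threshold `d = η ^ 8` is the one for which the blowup argument returns exactly `d ^ (r + 1)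
  -- = c`.
  by_cases hmany : ((r : ℝ) + 1) * η ^ 8 * (Fintype.card V : ℝ) ^ (r + 1) ≤
      (Finset.univ.filter fun x : Fin (r + 1) → V => IsCliqueTuple G x).card
  · left
    rw [← hd] at hn ⊢
    refine completePartiteOneLarge_isContained_of_many_cliques G hr (by positivity) ?_ hn ?_
    · have h4 : (4 : ℝ) ≤ r ^ 2 := by nlinarith
      calc 4 * 3 ^ r * η ^ 8 ≤ (r : ℝ) ^ 2 * (r ^ 2) ^ r * η ^ 2 := by
            have : η ^ 8 ≤ η ^ 2 := pow_le_pow_of_le_one hη0.le hη1 (by norm_num)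
            gcongr
            linarith
        _ = (r : ℝ) ^ (2 * r + 2) * η ^ 2 := by ring
        _ ≤ (r : ℝ) ^ (2 * (r + 21)) * η ^ 2 := by
            gcongr
            omega
        _ = (η * (r : ℝ) ^ (r + 21)) ^ 2 := by ring
        _ ≤ 1 := pow_le_one₀ (by positivity) hηr
    · convert hmany
  · right
    refine differsInFewerThan_of_few_cliques G hr hη0 hηr he0 her ?_ (by rw [heε]; exact hμ.le) ?_
    · have h1 : 1 / c ≤ Fintype.card V := by
        linarith [Real.add_one_le_exp (1 / c)]
      rw [div_le_iff₀ hc₀] at h1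
      refine h1.trans ?_
      gcongr
      rw [← hηc]
      exact pow_le_pow_of_le_one hη0.le hη1 (by omega)
    · convert (not_le.1 hmany).le
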